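/- Let $S^\infty$ denote the unit sphere of the real Hilbert space $\ell^2$ and, for an integer $M\ge 1$, let $S^M$ denote the unit sphere of $\mathbb{R}^{M+1}$. Let $P_l^M$ be the Gegenbauer polynomial of degree $l$ with parameter $(M-1)/2$ (for $M=1$, the Chebyshev polynomial of the first kind $T_l$), and put $R_l^M=P_l^M/P_l^M(1)$. Let $K$ be a continuous, isotropic, real-valued kernel on $S^\infty\times S^M$, that is, $K$ is continuous and $$K((x,z),(y,w))=f(x\cdot y,\,z\cdot w),\qquad x,y\in S^\infty,\ z,w\in S^M,$$ for a function $f:[-1,1]^2\to\mathbb{R}$ (the isotropic part of $K$). Then $K$ is positive definite on $S^\infty\times S^M$, that is, $$\sum_{\mu,\nu=1}^n c_\mu c_\nu K(p_\mu,p_\nu)\ge 0$$ for all $n\ge 1$, all distinct points $p_1,\dots,p_n\in S^\infty\times S^M$ and all real $c_1,\dots,c_n$, if and only if there are coefficients $c_{k,l}\ge 0$ $(k,l=0,1,2,\dots)$ with $\sum_{k,l=0}^\infty c_{k,l}<\infty$ such that $$f(t,s)=\sum_{k,l=0}^\infty c_{k,l}\,t^k R_l^M(s),\qquad t,s\in[-1,1].$$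 -/

import Mathlib

open Polynomial

noncomputable section

/-- The unit sphere `S^∞` of the real Hilbert space `ℓ²`. -/
abbrev SphereInf : Type := Metric.sphere (0 : lp (fun _ : ℕ => ℝ) 2) 1

/-- The unit sphere `S^M` of the Euclidean space `ℝ^(M+1)`. -/
abbrev SphereFin (M : ℕ) : Type := Metric.sphere (0 : EuclideanSpace ℝ (Fin (M + 1))) 1

/-- A real kernel on `X` is positive definite if all its quadratic forms at finitely many distinct
points are nonnegative. -/
def IsPositiveDefiniteKernel {X : Type*} (K : X → X → ℝ) : Prop :=
  ∀ (n : ℕ) (x : Fin n → X), Function.Injective x → ∀ c : Fin n → ℝ,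
    0 ≤ ∑ i, ∑ j, c i * c j * K (x i) (x j)

/-- `f` is an isotropic part of the kernel `K` on `S^∞ × S^M`. Only the values of `f` on `[-1,1]²`
matter. -/
def IsIsotropicPart {M : ℕ} (K : SphereInf × SphereFin M → SphereInf × SphereFin M → ℝ)
    (f : ℝ → ℝ → ℝ) : Prop :=
  ∀ (x y : SphereInf) (z w : SphereFin M),
    K (x, z) (y, w) =
      f (inner ℝ (x : lp (fun _ : ℕ => ℝ) 2) (y : lp (fun _ : ℕ => ℝ) 2))
        (inner ℝ (z : EuclideanSpace ℝ (Fin (M + 1))) (w : EuclideanSpace ℝ (Fin (M + 1))))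

/-- The Gegenbauer (ultraspherical) polynomials `C_n^(a)`, by their three-term recurrence
`(n+2) C_{n+2} = 2 (n+1+a) X C_{n+1} - (n+2a) C_n`. -/
def gegenbauer (a : ℝ) : ℕ → ℝ[X]
  | 0 => 1
  | 1 => C (2 * a) * X
  | n + 2 =>
      C (2 * ((n : ℝ) + 1 + a) / ((n : ℝ) + 2)) * X * gegenbauer a (n + 1)
        - C (((n : ℝ) + 2 * a) / ((n : ℝ) + 2)) * gegenbauer a n

/-- The polynomial `P_l^M` of degree `l` attached to the sphere `S^M`: the Gegenbauer polynomial
with parameter `(M-1)/2`. On the circle the parameter is `0`, and the usual convention replaces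
the degenerate family `C_l^(0)` by the Chebyshev polynomials of the first kind. -/
def sphereGegenbauer (M l : ℕ) : ℝ[X] :=
  if M = 1 then Polynomial.Chebyshev.T ℝ (l : ℤ) else gegenbauer (((M : ℝ) - 1) / 2) l

/-- The normalized polynomial function `R_l^M = P_l^M / P_l^M(1)`. -/
def normalizedGegenbauer (M l : ℕ) (s : ℝ) : ℝ :=
  (sphereGegenbauer M l).eval s / (sphereGegenbauer M l).eval 1

end

/-! Write `R_l` for `ultraspherical M l`, which is the normalized Gegenbauer polynomial
(`normalizedGegenbauer_eq`).

Sufficiency is a Schur product argument. Powers of an inner product are positive definite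
(`sum_mul_inner_pow_nonneg`). By the reproducing property `integral_ultraspherical_mul`, `R_l(z·w)`
is a positive multiple of an average over `v` of the rank-one kernels `R_l(z·v) R_l(w·v)`, so
multiplying by it preserves positivity.

For necessity, expand `F(t, ·)` in the `R_l`. The coefficient `∫∫ F(t, z·w) R_l(z·w)` is, as a
function of `t`, continuous and again positive definite on the Hilbert sphere
(`zonalCoeff_positive_definite`). Schoenberg's theorem then makes it a power series in `t` with
nonnegative coefficients; dividing these by the square norm of `R_l` gives `c k l`. At `t = 1` the
coefficients are nonnegative and `F(1, ·)` is bounded by `F(1, 1)`. Testing against the peaked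
functions `(1 + s)^n`, whose normalized multipliers are nonnegative and tend to 1, bounds all
partial sums (`sum_zonalCoeff_le`). The double series therefore converges uniformly, has the same
coefficients as `F(t, ·)`, and equals it by Weierstrass approximation.

Schoenberg's theorem is proved on cube vertices. Positivity there makes the Walsh coefficients of
`g` nonnegative. The Bernstein polynomials of `g`, expanded in powers of `t`, have sums of these as
coefficients, and they converge to `g`.

The analysis on `S^M` rests on one recursion for the moments `∫ ⟪z,v⟫^i ⟪w,v⟫^j`, obtained from
Gaussian integration by parts. Rotation invariance of zonal integrals, orthogonality and the
reproducing property all follow from it algebraically. -/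

noncomputable section

/-! ### Schoenberg's theorem on the Hilbert sphere -/

open Filter Topology Finset in
/-- A continuous function that is a pointwise limit on `[-1,1]` of power series with nonnegative
coefficients of bounded sum is itself such a power series. -/
theorem exists_hasSum_of_tendsto {g : ℝ → ℝ} (hg : Continuous g) (a : ℕ → ℕ → ℝ) (p : ℕ → ℝ → ℝ)
    (B : ℝ) (s : ℕ → ℝ) (ha : ∀ n k, 0 ≤ a n k) (hs : ∀ n, HasSum (a n) (s n)) (hsB : ∀ n, s n ≤ B)
    (hp : ∀ n, ∀ t ∈ Set.Icc (-1 : ℝ) 1, HasSum (fun k => a n k * t ^ k) (p n t))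
    (hpg : ∀ t ∈ Set.Icc (-1 : ℝ) 1, Tendsto (fun n => p n t) atTop (𝓝 (g t))) :
    ∃ b : ℕ → ℝ, (∀ k, 0 ≤ b k) ∧ Summable b ∧
      ∀ t ∈ Set.Icc (-1 : ℝ) 1, HasSum (fun k => b k * t ^ k) (g t) := by
  -- Limits along an ultrafilter exist for all coefficients at once, replacing a diagonal
  -- subsequence.
  have hU : (hyperfilter ℕ : Filter ℕ) ≤ atTop := Nat.hyperfilter_le_atTop
  have haB : ∀ n k, a n k ≤ B := fun n k =>
    (le_hasSum (hs n) k (fun j _ => ha n j)).trans (hsB n)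
  have hlim : ∀ k, ∃ b ∈ Set.Icc (0 : ℝ) B, Tendsto (fun n => a n k) (hyperfilter ℕ) (𝓝 b) := by
    intro k
    have := (isCompact_Icc (a := (0 : ℝ)) (b := B)).ultrafilter_le_nhds
      ((hyperfilter ℕ).map (fun n => a n k))
      (by
        rw [le_principal_iff]
        exact Filter.univ_mem' (f := (hyperfilter ℕ : Filter ℕ)) fun n => ⟨ha n k, haB n k⟩)
    exact this
  choose b hb hblim using hlim
  have hb0 : ∀ k, 0 ≤ b k := fun k => (hb k).1
  have hpart : ∀ S : Finset ℕ, ∑ k ∈ S, b k ≤ B := by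
    intro S
    refine le_of_tendsto (tendsto_finsetSum S fun k _ => hblim k) (Eventually.of_forall fun n => ?_)
    exact (sum_le_hasSum S (fun j _ => ha n j) (hs n)).trans (hsB n)
  have hbs : Summable b := summable_of_sum_le hb0 hpart
  refine ⟨b, hb0, hbs, ?_⟩
  have hterm : ∀ t ∈ Set.Icc (-1 : ℝ) 1, ∀ k, ‖b k * t ^ k‖ ≤ b k := by
    intro t ht k
    rw [norm_mul, norm_pow, Real.norm_of_nonneg (hb0 k), Real.norm_eq_abs]
    exact mul_le_of_le_one_right (hb0 k) (pow_le_one₀ (abs_nonneg t) (abs_le.2 ht))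
  have hsum : ∀ t ∈ Set.Icc (-1 : ℝ) 1, Summable fun k => b k * t ^ k := fun t ht =>
    Summable.of_norm_bounded hbs (hterm t ht)
  have hopen : ∀ t ∈ Set.Ioo (-1 : ℝ) 1, ∑' k, b k * t ^ k = g t := by
    intro t ht
    have ht' : t ∈ Set.Icc (-1 : ℝ) 1 := Set.Ioo_subset_Icc_self ht
    have htabs : |t| < 1 := abs_lt.2 ht
    -- Beyond the cutoff, `|t| ^ k ≤ |t| ^ N`, so the tail is controlled by the total mass `B`
    -- uniformly in `n`. This tends to zero only for `|t| < 1`; the endpoints are recovered by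
    -- continuity of both sides.
    have hbound : ∀ N, |g t - ∑ k ∈ range N, b k * t ^ k| ≤ B * |t| ^ N := by
      intro N
      have h1 : Tendsto (fun n => |p n t - ∑ k ∈ range N, a n k * t ^ k|) (hyperfilter ℕ)
          (𝓝 |g t - ∑ k ∈ range N, b k * t ^ k|) :=
        (((hpg t ht').mono_left hU).sub
          (tendsto_finsetSum _ fun k _ => (hblim k).mul_const _)).abs
      refine le_of_tendsto h1 (Eventually.of_forall fun n => ?_)
      have h2 : HasSum (fun k => if k ∈ range N then a n k * t ^ k else 0)
          (∑ k ∈ range N, a n k * t ^ k) := by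
        have := hasSum_sum_of_ne_finset_zero (L := .unconditional ℕ) (s := range N)
          (f := fun k => if k ∈ range N then a n k * t ^ k else 0)
          (fun k hk => if_neg hk)
        rwa [Finset.sum_congr rfl (fun k hk => if_pos hk)] at this
      have h3 := (hp n t ht').sub h2
      rw [← h3.tsum_eq, ← Real.norm_eq_abs]
      have h4 : HasSum (fun k => a n k * |t| ^ N) (s n * |t| ^ N) := (hs n).mul_right _
      refine (tsum_of_norm_bounded h4 fun k => ?_).trans
        (mul_le_mul_of_nonneg_right (hsB n) (by positivity))
      by_cases hk : k ∈ range N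
      · simp only [hk, if_true, sub_self, norm_zero]
        exact mul_nonneg (ha n k) (by positivity)
      · simp only [hk, if_false, sub_zero, norm_mul, norm_pow, Real.norm_eq_abs,
          abs_of_nonneg (ha n k)]
        exact mul_le_mul_of_nonneg_left
          (pow_le_pow_of_le_one (abs_nonneg t) htabs.le (by simpa using hk)) (ha n k)
    have h5 : Tendsto (fun N => ∑ k ∈ range N, b k * t ^ k) atTop (𝓝 (g t)) := by
      have h6 : Tendsto (fun N => B * |t| ^ N) atTop (𝓝 0) := by
        simpa using (tendsto_pow_atTop_nhds_zero_of_lt_one (abs_nonneg t) htabs).const_mul B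
      rw [tendsto_iff_norm_sub_tendsto_zero]
      refine squeeze_zero (fun _ => norm_nonneg _) (fun N => ?_) h6
      rw [norm_sub_rev]
      exact hbound N
    exact tendsto_nhds_unique (hsum t ht').hasSum.tendsto_sum_nat h5
  have hcont : ContinuousOn (fun t : ℝ => ∑' k, b k * t ^ k) (Set.Icc (-1) 1) :=
    continuousOn_tsum (fun k => by fun_prop) hbs (fun k t ht => hterm t ht k)
  have hcl : Set.Icc (-1 : ℝ) 1 ⊆ closure (Set.Ioo (-1 : ℝ) 1) := by
    rw [closure_Ioo (by norm_num)]
  have heq : Set.EqOn (fun t : ℝ => ∑' k, b k * t ^ k) g (Set.Icc (-1) 1) :=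
    Set.EqOn.of_subset_closure (fun t ht => hopen t ht) hcont hg.continuousOn
      Set.Ioo_subset_Icc_self hcl
  intro t ht
  have := (hsum t ht).hasSum
  rwa [show (∑' k, b k * t ^ k) = g t from heq ht] at this

-- Repeated points can be merged by adding their coefficients. This frees later applications from
-- checking injectivity.
open Finset in
theorem IsPositiveDefiniteKernel.sum_nonneg {X : Type*} {K : X → X → ℝ}
    (hK : IsPositiveDefiniteKernel K) {ι : Type*} [Fintype ι] (x : ι → X) (c : ι → ℝ) :
    0 ≤ ∑ i, ∑ j, c i * c j * K (x i) (x j) := by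
  classical
  let s : Finset X := univ.image x
  let e : Fin s.card ≃ s := s.equivFin.symm
  let C : X → ℝ := fun p => ∑ i with x i = p, c i
  have h := hK s.card (fun i => (e i : X)) (Subtype.val_injective.comp e.injective)
    (fun i => C (e i))
  have key : ∀ G : X → ℝ, ∑ i, c i * G (x i) = ∑ k, C (e k) * G (e k) := by
    intro G
    rw [e.sum_comp (fun p : s => C p * G p), Finset.sum_coe_sort s (fun p => C p * G p)]
    rw [← Finset.sum_fiberwise_of_maps_to (s := univ) (t := s) (g := x)
      (fun i _ => mem_image_of_mem x (mem_univ i))]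
    refine Finset.sum_congr rfl fun p _ => ?_
    simp only [C, Finset.sum_mul]
    refine Finset.sum_congr rfl fun i hi => ?_
    rw [(Finset.mem_filter.1 hi).2]
  have e1 : ∑ i, ∑ j, c i * c j * K (x i) (x j)
      = ∑ k, ∑ m, C (e k) * C (e m) * K (e k) (e m) := by
    calc _ = ∑ i, c i * ∑ j, c j * K (x i) (x j) := by
          simp only [Finset.mul_sum, mul_assoc]
      _ = ∑ i, c i * ∑ m, C (e m) * K (x i) (e m) := by
          refine Finset.sum_congr rfl fun i _ => ?_
          rw [key (fun y => K (x i) y)]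
      _ = ∑ k, C (e k) * ∑ m, C (e m) * K (e k) (e m) :=
          key (fun y => ∑ m, C (e m) * K y (e m))
      _ = _ := by simp only [Finset.mul_sum, mul_assoc]
  rw [e1]
  exact h

/-- Finite sets correspond to sign vectors. -/
def finsetEquivSigns (n : ℕ) : Finset (Fin n) ≃ (Fin n → ℤˣ) where
  toFun T i := if i ∈ T then 1 else -1
  invFun z := Finset.univ.filter fun i => z i = 1
  left_inv T := by ext i; simp
  right_inv z := by
    funext i
    rcases Int.units_eq_one_or (z i) with h | h <;> simp [h]

/-- The vertices of the cube of dimension `n`, as points of the unit sphere of `ℓ²`. -/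
theorem exists_cube_points (n : ℕ) (hn : 0 < n) : ∃ x : (Fin n → ℤˣ) → SphereInf, ∀ u v,
    inner ℝ (x u : lp (fun _ : ℕ => ℝ) 2) (x v : lp (fun _ : ℕ => ℝ) 2)
      = (∑ i, (((u i * v i : ℤˣ) : ℤ) : ℝ)) / n := by
  classical
  let e : ℕ → lp (fun _ : ℕ => ℝ) 2 := fun i => lp.single 2 i (1 : ℝ)
  have he : Orthonormal ℝ e := by
    rw [orthonormal_iff_ite]
    intro i j
    simp only [e, lp.inner_single_left]
    by_cases h : i = j
    · subst h; simp
    · simp [h, lp.single_apply]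
  have hef : Orthonormal ℝ (fun i : Fin n => e i) := he.comp _ Fin.val_injective
  let y : (Fin n → ℤˣ) → lp (fun _ : ℕ => ℝ) 2 := fun u =>
    ∑ i, ((((u i : ℤˣ) : ℤ) : ℝ) / Real.sqrt n) • e i
  have hy : ∀ u v, inner ℝ (y u) (y v) = (∑ i, (((u i * v i : ℤˣ) : ℤ) : ℝ)) / n := by
    intro u v
    rw [hef.inner_sum, Finset.sum_div]
    refine Finset.sum_congr rfl fun i _ => ?_
    have : Real.sqrt n * Real.sqrt n = n := Real.mul_self_sqrt (by positivity)
    simp only [conj_trivial, Units.val_mul, Int.cast_mul]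
    rw [div_mul_div_comm, this]
  refine ⟨fun u => ⟨y u, ?_⟩, hy⟩
  rw [mem_sphere_zero_iff_norm, ← sq_eq_sq₀ (norm_nonneg _) zero_le_one,
    ← real_inner_self_eq_norm_sq, hy]
  have : ∀ i, u i * u i = 1 := fun i => Int.units_mul_self _
  simp [this, hn.ne']

-- Test the kernel on the cube vertices with the Walsh character of `S` as coefficients. The kernel
-- depends only on `u * v` and the character is multiplicative, so the quadratic form is the number
-- of vertices times the Walsh sum.
open Finset in
theorem cube_fourier_nonneg {g : ℝ → ℝ}
    (hg : IsPositiveDefiniteKernel fun x y : SphereInf =>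
      g (inner ℝ (x : lp (fun _ : ℕ => ℝ) 2) (y : lp (fun _ : ℕ => ℝ) 2)))
    (n : ℕ) (hn : 0 < n) (S : Finset (Fin n)) :
    0 ≤ ∑ z : Fin n → ℤˣ, (∏ i ∈ S, (((z i : ℤˣ) : ℤ) : ℝ)) * g ((∑ i, (((z i : ℤˣ) : ℤ) : ℝ)) / n) := by
  obtain ⟨x, hx⟩ := exists_cube_points n hn
  have h := hg.sum_nonneg x (fun u => ∏ i ∈ S, (((u i : ℤˣ) : ℤ) : ℝ))
  simp only [hx] at h
  have e1 : ∀ u : Fin n → ℤˣ,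
      ∑ v : Fin n → ℤˣ, (∏ i ∈ S, (((u i : ℤˣ) : ℤ) : ℝ)) * (∏ i ∈ S, (((v i : ℤˣ) : ℤ) : ℝ)) *
        g ((∑ i, (((u i * v i : ℤˣ) : ℤ) : ℝ)) / n)
      = ∑ z : Fin n → ℤˣ, (∏ i ∈ S, (((z i : ℤˣ) : ℤ) : ℝ)) *
        g ((∑ i, (((z i : ℤˣ) : ℤ) : ℝ)) / n) := by
    intro u
    refine Fintype.sum_equiv (Equiv.mulLeft u) _ _ fun v => ?_
    simp only [Equiv.coe_mulLeft, Pi.mul_apply]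
    rw [← Finset.prod_mul_distrib]
    simp only [Units.val_mul, Int.cast_mul]
  rw [Finset.sum_congr rfl (fun u _ => e1 u), Finset.sum_const, nsmul_eq_mul] at h
  refine nonneg_of_mul_nonneg_right h ?_
  have : 0 < (univ : Finset (Fin n → ℤˣ)).card := Finset.card_pos.2 ⟨1, mem_univ _⟩
  exact_mod_cast this

open Finset in
/-- The Bernstein polynomial on `[-1,1]` as an expectation over random signs, expanded in monomials. -/
theorem bernstein_eq_sum_signs (g : ℝ → ℝ) (n : ℕ) (hn : 0 < n) (t : ℝ) :
    ∑ k ∈ range (n + 1), (n.choose k : ℝ) * ((1 + t) / 2) ^ k * (1 - (1 + t) / 2) ^ (n - k) *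
        g (2 * (k / n) - 1)
      = ∑ S : Finset (Fin n), ((2 : ℝ)⁻¹ ^ n *
          ∑ z : Fin n → ℤˣ, (∏ i ∈ S, (((z i : ℤˣ) : ℤ) : ℝ)) *
            g ((∑ i, (((z i : ℤˣ) : ℤ) : ℝ)) / n)) * t ^ S.card := by
  have e1 := Finset.sum_powerset_apply_card (x := (univ : Finset (Fin n)))
    (fun k => ((1 + t) / 2) ^ k * (1 - (1 + t) / 2) ^ (n - k) * g (2 * ((k : ℝ) / n) - 1))
  simp only [Finset.powerset_univ, Finset.card_univ, Fintype.card_fin, nsmul_eq_mul] at e1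
  calc _ = ∑ T : Finset (Fin n), ((1 + t) / 2) ^ T.card * (1 - (1 + t) / 2) ^ (n - T.card) *
        g (2 * ((T.card : ℝ) / n) - 1) := by
        rw [e1]; exact Finset.sum_congr rfl fun _ _ => by ring
    -- `T` is the set of plus signs: the binomial weights become a product law on signs, each of
    -- mean `t`.
    _ = ∑ z : Fin n → ℤˣ, (∏ i, ((1 + (((z i : ℤˣ) : ℤ) : ℝ) * t) / 2)) *
          g ((∑ i, (((z i : ℤˣ) : ℤ) : ℝ)) / n) := by
        rw [← (finsetEquivSigns n).sum_comp]
        refine Finset.sum_congr rfl fun T _ => ?_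
        have a1 : ∏ i, ((1 + (((finsetEquivSigns n T i : ℤˣ) : ℤ) : ℝ) * t) / 2)
            = ((1 + t) / 2) ^ T.card * (1 - (1 + t) / 2) ^ (n - T.card) := by
          have : ∀ i, ((1 + (((finsetEquivSigns n T i : ℤˣ) : ℤ) : ℝ) * t) / 2)
              = if i ∈ T then (1 + t) / 2 else 1 - (1 + t) / 2 := by
            intro i
            by_cases h : i ∈ T
            · simp [finsetEquivSigns, h]
            · simp [finsetEquivSigns, h]; ring
          rw [Finset.prod_congr rfl fun i _ => this i, Finset.prod_ite, Finset.prod_const, Finset.prod_const]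
          simp only [Finset.filter_not, ← Finset.compl_eq_univ_sdiff, Finset.card_compl,
            Finset.filter_univ_mem, Fintype.card_fin]
        have a2 : ∑ i, (((finsetEquivSigns n T i : ℤˣ) : ℤ) : ℝ) = 2 * T.card - n := by
          have : ∀ i, (((finsetEquivSigns n T i : ℤˣ) : ℤ) : ℝ)
              = 2 * (if i ∈ T then (1 : ℝ) else 0) - 1 := by
            intro i
            by_cases h : i ∈ T
            · simp [finsetEquivSigns, h]; norm_num
            · simp [finsetEquivSigns, h]
          rw [Finset.sum_congr rfl fun i _ => this i, Finset.sum_sub_distrib, ← Finset.mul_sum]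
          simp
        rw [a1, a2]
        congr 2
        have : (n : ℝ) ≠ 0 := by positivity
        field_simp
    -- Expanding `∏ (1 + z i * t)` over subsets makes the Walsh characters appear, each with the
    -- power `t ^ S.card`.
    _ = ∑ z : Fin n → ℤˣ, ∑ S : Finset (Fin n), (2 : ℝ)⁻¹ ^ n *
          ((∏ i ∈ S, (((z i : ℤˣ) : ℤ) : ℝ)) * t ^ S.card) *
            g ((∑ i, (((z i : ℤˣ) : ℤ) : ℝ)) / n) := by
        refine Finset.sum_congr rfl fun z _ => ?_
        rw [← Finset.sum_mul, ← Finset.mul_sum]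
        congr 1
        rw [Finset.prod_div_distrib, Finset.prod_one_add, Finset.powerset_univ]
        simp only [Finset.prod_mul_distrib, Finset.prod_const, Finset.card_univ, Fintype.card_fin]
        rw [div_eq_inv_mul, inv_pow]
    _ = _ := by
        rw [Finset.sum_comm]
        refine Finset.sum_congr rfl fun S _ => ?_
        rw [Finset.mul_sum, Finset.sum_mul]
        exact Finset.sum_congr rfl fun z _ => by ring

open Filter Topology Finset in
/-- Schoenberg's theorem on the Hilbert sphere. -/
theorem schoenberg_sphereInf {g : ℝ → ℝ} (hgc : Continuous g)
    (hg : IsPositiveDefiniteKernel fun x y : SphereInf =>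
      g (inner ℝ (x : lp (fun _ : ℕ => ℝ) 2) (y : lp (fun _ : ℕ => ℝ) 2))) :
    ∃ b : ℕ → ℝ, (∀ k, 0 ≤ b k) ∧ Summable b ∧
      ∀ t ∈ Set.Icc (-1 : ℝ) 1, HasSum (fun k => b k * t ^ k) (g t) := by
  classical
  let w : ∀ n : ℕ, Finset (Fin n) → ℝ := fun n S => (2 : ℝ)⁻¹ ^ n *
    ∑ z : Fin n → ℤˣ, (∏ i ∈ S, (((z i : ℤˣ) : ℤ) : ℝ)) * g ((∑ i, (((z i : ℤˣ) : ℤ) : ℝ)) / n)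
  have hw : ∀ n, 0 < n → ∀ S, 0 ≤ w n S := fun n hn S =>
    mul_nonneg (by positivity) (cube_fourier_nonneg hg n hn S)
  -- The shift to `n + 1` avoids the empty cube, where the mean of the signs would divide by zero.
  let p : ℕ → ℝ → ℝ := fun n t => ∑ S : Finset (Fin (n + 1)), w (n + 1) S * t ^ S.card
  let a : ℕ → ℕ → ℝ := fun n k => ∑ S : Finset (Fin (n + 1)) with S.card = k, w (n + 1) S
  have hp : ∀ n t, HasSum (fun k => a n k * t ^ k) (p n t) := by
    intro n t
    have h1 : ∀ k ∉ range (n + 2), a n k * t ^ k = 0 := by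
      intro k hk
      have : (univ.filter fun S : Finset (Fin (n + 1)) => S.card = k) = ∅ := by
        refine Finset.filter_eq_empty_iff.2 fun S _ hS => hk ?_
        have := Finset.card_le_univ S
        simp at this ⊢
        omega
      simp only [a]
      rw [this, Finset.sum_empty, zero_mul]
    have h2 := hasSum_sum_of_ne_finset_zero (L := .unconditional ℕ) h1
    convert! h2 using 1
    simp only [p, a]
    rw [← Finset.sum_fiberwise_of_maps_to (s := univ) (t := range (n + 2)) (g := Finset.card)
      (fun S _ => by have := Finset.card_le_univ S; simp at this ⊢; omega)]
    refine Finset.sum_congr rfl fun k _ => ?_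
    rw [Finset.sum_mul]
    refine Finset.sum_congr rfl fun S hS => ?_
    rw [(Finset.mem_filter.1 hS).2]
  have hpB : ∀ n t, p n t = ∑ k ∈ range (n + 1 + 1), ((n + 1).choose k : ℝ) * ((1 + t) / 2) ^ k *
      (1 - (1 + t) / 2) ^ (n + 1 - k) * g (2 * (k / (n + 1 : ℕ)) - 1) := fun n t =>
    (bernstein_eq_sum_signs g (n + 1) n.succ_pos t).symm
  -- Bernstein polynomials interpolate at the endpoint, so the coefficient sums all equal `g 1`;
  -- this is the uniform bound needed for the limit.
  have hp1 : ∀ n, p n 1 = g 1 := by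
    intro n
    rw [hpB, Finset.sum_eq_single (n + 1)]
    · have : ((n + 1 : ℕ) : ℝ) ≠ 0 := by positivity
      rw [div_self this]; norm_num
    · intro k hk hk'
      have : n + 1 - k ≠ 0 := by simp at hk; omega
      simp [this]
    · simp
  refine exists_hasSum_of_tendsto hgc a p (g 1) (fun n => p n 1)
    (fun n k => Finset.sum_nonneg fun S _ => hw _ n.succ_pos S) (fun n => by simpa using hp n 1)
    (fun n => (hp1 n).le) (fun n t _ => hp n t) (fun t ht => ?_)
  let G : C(unitInterval, ℝ) := ⟨fun u => g (2 * (u : ℝ) - 1), by fun_prop⟩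
  have hu : (1 + t) / 2 ∈ unitInterval := ⟨by linarith [ht.1], by linarith [ht.2]⟩
  have hB := bernsteinApproximation_uniform G
  have hB1 := ((ContinuousEvalConst.continuous_eval_const (F := C(unitInterval, ℝ))
    (⟨(1 + t) / 2, hu⟩ : unitInterval)).tendsto G).comp (hB.comp (tendsto_add_atTop_nat 1))
  convert! hB1 using 1
  · funext n
    rw [hpB]
    simp only [Function.comp_apply, bernsteinApproximation, ContinuousMap.sum_apply, smul_eq_mul,
      ContinuousMap.mul_apply, bernstein_apply, ContinuousMap.const_apply]
    rw [Finset.sum_range]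
    rfl
  · simp only [G, ContinuousMap.coe_mk]
    congr 2; ring

/-! ### Polar coordinates and Gaussian moments -/

-- In polar coordinates homogeneity splits `F v` into `‖v‖ ^ k` and its value on the sphere. This is
-- the bridge from Gaussian integrals to spherical ones.
open MeasureTheory Set in
theorem integral_homogeneous_mul_radial {E : Type*} [NormedAddCommGroup E] [NormedSpace ℝ E]
    [MeasurableSpace E] [BorelSpace E] [FiniteDimensional ℝ E] [Nontrivial E] (μ : Measure E)
    [μ.IsAddHaarMeasure] (F : E → ℝ) (k : ℕ) (g : ℝ → ℝ)
    (hF : ∀ (r : ℝ) (v : E), F (r • v) = r ^ k * F v) :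
    ∫ v, F v * g ‖v‖ ∂μ = (∫ ω : Metric.sphere (0 : E) 1, F ω ∂μ.toSphere) *
      ∫ r in Ioi (0 : ℝ), r ^ (Module.finrank ℝ E - 1) * (r ^ k * g r) := by
  calc ∫ v, F v * g ‖v‖ ∂μ
      = ∫ x : ({(0)}ᶜ : Set E), F x.1 * g ‖x.1‖ ∂(μ.comap (↑)) := by
        rw [integral_subtype_comap (measurableSet_singleton _).compl fun x ↦ F x * g ‖x‖,
          restrict_compl_singleton]
    _ = ∫ x : Metric.sphere (0 : E) 1 × Ioi (0 : ℝ), F x.1 * ((x.2 : ℝ) ^ k * g x.2)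
          ∂μ.toSphere.prod (.volumeIoiPow (Module.finrank ℝ E - 1)) := by
        rw [← μ.measurePreserving_homeomorphUnitSphereProd.integral_comp
          (Homeomorph.measurableEmbedding _)]
        refine integral_congr_ae (Filter.Eventually.of_forall fun x => ?_)
        have hx : ‖(x : E)‖ ≠ 0 := norm_ne_zero_iff.2 x.2
        simp only [homeomorphUnitSphereProd_apply_fst_coe, homeomorphUnitSphereProd_apply_snd_coe,
          hF]
        rw [inv_pow]
        field_simp
    _ = (∫ ω : Metric.sphere (0 : E) 1, F ω ∂μ.toSphere) *
          ∫ r : Ioi (0 : ℝ), (r : ℝ) ^ k * g r ∂.volumeIoiPow (Module.finrank ℝ E - 1) :=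
        integral_prod_mul (fun ω : Metric.sphere (0 : E) 1 => F ω)
          (fun r : Ioi (0 : ℝ) => (r : ℝ) ^ k * g r)
    _ = _ := by
      congr 1
      simp only [Measure.volumeIoiPow, ENNReal.ofReal]
      rw [integral_withDensity_eq_integral_smul,
        integral_subtype_comap measurableSet_Ioi
          fun a ↦ Real.toNNReal (a ^ (Module.finrank ℝ E - 1)) • (a ^ k * g a),
        setIntegral_congr_fun measurableSet_Ioi fun x hx ↦ ?_]
      · rw [NNReal.smul_def, Real.coe_toNNReal _ (pow_nonneg hx.out.le _), smul_eq_mul]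
      · exact (measurable_subtype_coe.pow_const _).real_toNNReal

/-- Radial moments of the Gaussian weight. -/
def gaussianRadialMoment (n : ℕ) : ℝ := ∫ r in Set.Ioi (0 : ℝ), r ^ n * Real.exp (-(1 / 2) * r ^ 2)

theorem gaussianRadialMoment_eq (n : ℕ) : gaussianRadialMoment n =
    (1 / 2 : ℝ) ^ (-((n : ℝ) + 1) / 2) * (1 / 2) * Real.Gamma (((n : ℝ) + 1) / 2) := by
  have := integral_rpow_mul_exp_neg_mul_rpow (p := 2) (q := n) (b := 1 / 2) (by norm_num)
    (by have : (0 : ℝ) ≤ n := n.cast_nonneg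
        linarith) (by norm_num)
  rw [← this]
  simp only [gaussianRadialMoment, Real.rpow_natCast, Real.rpow_ofNat]

theorem gaussianRadialMoment_pos (n : ℕ) : 0 < gaussianRadialMoment n := by
  rw [gaussianRadialMoment_eq]
  have : 0 < Real.Gamma (((n : ℝ) + 1) / 2) := Real.Gamma_pos_of_pos (by positivity)
  positivity

/-- The functional equation of Gamma. It is the source of the factor `i + j + M` in the spherical
moment recursion. -/
theorem gaussianRadialMoment_add_two (n : ℕ) :
    gaussianRadialMoment (n + 2) = (n + 1) * gaussianRadialMoment n := by
  rw [gaussianRadialMoment_eq, gaussianRadialMoment_eq]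
  have h1 : (((n + 2 : ℕ) : ℝ) + 1) / 2 = ((n : ℝ) + 1) / 2 + 1 := by push_cast; ring
  have h2 : -(((n + 2 : ℕ) : ℝ) + 1) / 2 = -((n : ℝ) + 1) / 2 - 1 := by push_cast; ring
  rw [h1, h2, Real.Gamma_add_one (by positivity), Real.rpow_sub (by norm_num), Real.rpow_one]
  ring

section Gaussian

variable {M : ℕ}

open MeasureTheory

theorem integrable_norm_pow_mul_gaussian (k : ℕ) :
    Integrable fun v : EuclideanSpace ℝ (Fin (M + 1)) =>
      ‖v‖ ^ k * Real.exp (-(1 / 2) * ‖v‖ ^ 2) := by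
  rw [integrable_fun_norm_addHaar (E := EuclideanSpace ℝ (Fin (M + 1))) volume
    (f := fun r : ℝ => r ^ k * Real.exp (-(1 / 2) * r ^ 2))]
  have h := integrable_rpow_mul_exp_neg_mul_sq (b := 1 / 2) (by norm_num)
    (s := ((M + k : ℕ) : ℝ)) (by
      have : (0 : ℝ) ≤ ((M + k : ℕ) : ℝ) := Nat.cast_nonneg _
      linarith)
  refine h.integrableOn.congr_fun (fun r _ => ?_) measurableSet_Ioi
  simp only [Real.rpow_natCast, finrank_euclideanSpace_fin, Nat.add_sub_cancel, smul_eq_mul, pow_add]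
  ring

theorem integrable_inner_pow_mul_gaussian (z w : EuclideanSpace ℝ (Fin (M + 1))) (i j : ℕ) :
    Integrable fun v : EuclideanSpace ℝ (Fin (M + 1)) =>
      inner ℝ z v ^ i * inner ℝ w v ^ j * Real.exp (-(1 / 2) * ‖v‖ ^ 2) := by
  refine ((integrable_norm_pow_mul_gaussian (M := M) (i + j)).const_mul
    (‖z‖ ^ i * ‖w‖ ^ j)).mono' (by fun_prop) (Filter.Eventually.of_forall fun v => ?_)
  rw [norm_mul, norm_mul, norm_pow, norm_pow, Real.norm_of_nonneg (Real.exp_pos _).le]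
  calc ‖inner ℝ z v‖ ^ i * ‖inner ℝ w v‖ ^ j * Real.exp (-(1 / 2) * ‖v‖ ^ 2)
      ≤ (‖z‖ * ‖v‖) ^ i * (‖w‖ * ‖v‖) ^ j * Real.exp (-(1 / 2) * ‖v‖ ^ 2) := by
        gcongr <;> exact norm_inner_le_norm _ _
    _ = _ := by ring

/-- Differentiate in the direction `z`: the Gaussian yields `-⟪z,v⟫` and the monomials yield the two
terms on the right. The truncated exponents `i - 1` and `j - 1` are harmless, since their terms
carry the factors `i` and `j`. -/
theorem gaussian_integration_by_parts (z w : EuclideanSpace ℝ (Fin (M + 1))) (i j : ℕ) :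
    ∫ v, inner ℝ z v ^ (i + 1) * inner ℝ w v ^ j * Real.exp (-(1 / 2) * ‖v‖ ^ 2)
      = i * inner ℝ z z *
          (∫ v, inner ℝ z v ^ (i - 1) * inner ℝ w v ^ j * Real.exp (-(1 / 2) * ‖v‖ ^ 2))
        + j * inner ℝ z w *
          ∫ v, inner ℝ z v ^ i * inner ℝ w v ^ (j - 1) * Real.exp (-(1 / 2) * ‖v‖ ^ 2) := by
  have hd : ∀ u v : EuclideanSpace ℝ (Fin (M + 1)),
      HasLineDerivAt ℝ (fun v => inner ℝ u v) (inner ℝ z u) v z := by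
    intro u v
    have h := ((innerSL ℝ u).hasFDerivAt (x := v)).hasLineDerivAt z
    rw [innerSL_apply_apply, real_inner_comm] at h
    exact h
  have hf : ∀ v : EuclideanSpace ℝ (Fin (M + 1)),
      HasLineDerivAt ℝ (fun v => inner ℝ z v ^ i * inner ℝ w v ^ j)
        (i * inner ℝ z z * (inner ℝ z v ^ (i - 1) * inner ℝ w v ^ j) +
          j * inner ℝ z w * (inner ℝ z v ^ i * inner ℝ w v ^ (j - 1))) v z := by
    intro v
    have h1 := hd z v
    have h2 := hd w v
    unfold HasLineDerivAt at h1 h2 ⊢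
    convert! (h1.pow i).mul (h2.pow j) using 1
    simp only [zero_smul, add_zero, Pi.pow_apply]
    ring
  have hg : ∀ v : EuclideanSpace ℝ (Fin (M + 1)),
      HasLineDerivAt ℝ (fun v => Real.exp (-(1 / 2) * ‖v‖ ^ 2))
        (-(inner ℝ z v * Real.exp (-(1 / 2) * ‖v‖ ^ 2))) v z := by
    intro v
    have h0 : HasFDerivAt (fun v : EuclideanSpace ℝ (Fin (M + 1)) => ‖v‖ ^ 2)
        (2 • (innerSL ℝ v)) v := (hasStrictFDerivAt_norm_sq v).hasFDerivAt
    have h1 := h0.hasLineDerivAt z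
    unfold HasLineDerivAt at h1 ⊢
    convert! (h1.const_mul (-(1 / 2))).exp using 1
    simp only [zero_smul, add_zero, smul_apply, innerSL_apply_apply]
    rw [real_inner_comm]
    simp
    ring
  have I1 : ∀ v : EuclideanSpace ℝ (Fin (M + 1)),
      inner ℝ z v ^ i * inner ℝ w v ^ j * -(inner ℝ z v * Real.exp (-(1 / 2) * ‖v‖ ^ 2))
      = -(inner ℝ z v ^ (i + 1) * inner ℝ w v ^ j * Real.exp (-(1 / 2) * ‖v‖ ^ 2)) := by
    intro v; ring
  have I2 : ∀ v : EuclideanSpace ℝ (Fin (M + 1)),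
      (i * inner ℝ z z * (inner ℝ z v ^ (i - 1) * inner ℝ w v ^ j) +
          j * inner ℝ z w * (inner ℝ z v ^ i * inner ℝ w v ^ (j - 1))) *
            Real.exp (-(1 / 2) * ‖v‖ ^ 2)
      = i * inner ℝ z z * (inner ℝ z v ^ (i - 1) * inner ℝ w v ^ j *
            Real.exp (-(1 / 2) * ‖v‖ ^ 2)) +
          j * inner ℝ z w * (inner ℝ z v ^ i * inner ℝ w v ^ (j - 1) *
            Real.exp (-(1 / 2) * ‖v‖ ^ 2)) := by
    intro v; ring
  have J1 := (integrable_inner_pow_mul_gaussian z w (i - 1) j).const_mul (i * inner ℝ z z)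
  have J2 := (integrable_inner_pow_mul_gaussian z w i (j - 1)).const_mul (j * inner ℝ z w)
  have key := integral_bilinear_hasLineDerivAt_right_eq_neg_left_of_integrable
    (μ := (volume : Measure (EuclideanSpace ℝ (Fin (M + 1))))) (B := ContinuousLinearMap.mul ℝ ℝ)
    (v := z)
    (f := fun v => inner ℝ z v ^ i * inner ℝ w v ^ j)
    (g := fun v => Real.exp (-(1 / 2) * ‖v‖ ^ 2))
    (f' := fun v => i * inner ℝ z z * (inner ℝ z v ^ (i - 1) * inner ℝ w v ^ j) +
          j * inner ℝ z w * (inner ℝ z v ^ i * inner ℝ w v ^ (j - 1)))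
    (g' := fun v => -(inner ℝ z v * Real.exp (-(1 / 2) * ‖v‖ ^ 2)))
    (by simp only [ContinuousLinearMap.mul_apply', I2]; exact J1.add J2)
    (by
      simp only [ContinuousLinearMap.mul_apply', I1]
      exact (integrable_inner_pow_mul_gaussian z w (i + 1) j).neg)
    (integrable_inner_pow_mul_gaussian z w i j) (fun v _ => hf v) (fun v _ => hg v)
  simp only [ContinuousLinearMap.mul_apply', I1, I2] at key
  rw [integral_neg, neg_inj, integral_add J1 J2, integral_const_mul, integral_const_mul] at key
  exact key

end Gaussian

/-! ### Moments of the sphere -/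

section Sphere

variable {M : ℕ}

open MeasureTheory

/-- The rotation invariant probability measure on the unit sphere `S^M`. -/
def sphereProb (M : ℕ) : Measure (SphereFin M) :=
  ((volume : Measure (EuclideanSpace ℝ (Fin (M + 1)))).toSphere Set.univ)⁻¹ •
    (volume : Measure (EuclideanSpace ℝ (Fin (M + 1)))).toSphere

theorem toSphere_univ_ne_zero (M : ℕ) :
    (volume : Measure (EuclideanSpace ℝ (Fin (M + 1)))).toSphere Set.univ ≠ 0 := by
  rw [Ne, Measure.measure_univ_eq_zero]
  exact Measure.toSphere_ne_zero _

instance (M : ℕ) : IsProbabilityMeasure (sphereProb M) := by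
  refine ⟨?_⟩
  rw [sphereProb, Measure.smul_apply, smul_eq_mul,
    ENNReal.inv_mul_cancel (toSphere_univ_ne_zero M) (measure_ne_top _ _)]

instance (M : ℕ) : (sphereProb M).IsOpenPosMeasure := by
  refine ⟨fun U hU hne => ?_⟩
  rw [sphereProb, Measure.smul_apply, smul_eq_mul]
  exact mul_ne_zero (ENNReal.inv_ne_zero.2 (measure_ne_top _ _)) (hU.measure_ne_zero _ hne)

/-- The mixed moments `∫ ⟪z,v⟫^i ⟪w,v⟫^j` of the sphere. -/
def sphereMoment (z w : EuclideanSpace ℝ (Fin (M + 1))) (i j : ℕ) : ℝ :=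
  ∫ v : SphereFin M, inner ℝ z (v : EuclideanSpace ℝ (Fin (M + 1))) ^ i *
    inner ℝ w (v : EuclideanSpace ℝ (Fin (M + 1))) ^ j ∂sphereProb M

theorem gaussian_moment_eq (z w : EuclideanSpace ℝ (Fin (M + 1))) (i j : ℕ) :
    ∫ v, inner ℝ z v ^ i * inner ℝ w v ^ j * Real.exp (-(1 / 2) * ‖v‖ ^ 2)
      = ((volume : Measure (EuclideanSpace ℝ (Fin (M + 1)))).toSphere Set.univ).toReal *
        sphereMoment z w i j * gaussianRadialMoment (M + (i + j)) := by
  have h := integral_homogeneous_mul_radial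
    (volume : Measure (EuclideanSpace ℝ (Fin (M + 1))))
    (fun v => inner ℝ z v ^ i * inner ℝ w v ^ j) (i + j)
    (fun r => Real.exp (-(1 / 2) * r ^ 2)) (by
      intro r v
      simp only [inner_smul_right]
      ring)
  rw [h]
  have h0 : ((volume : Measure (EuclideanSpace ℝ (Fin (M + 1)))).toSphere Set.univ).toReal ≠ 0 :=
    ENNReal.toReal_ne_zero.2 ⟨toSphere_univ_ne_zero M, measure_ne_top _ _⟩
  congr 1
  · rw [sphereMoment, sphereProb, integral_smul_measure, smul_eq_mul, ENNReal.toReal_inv,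
      mul_inv_cancel_left₀ h0]
  · rw [gaussianRadialMoment]
    simp only [finrank_euclideanSpace_fin, Nat.add_sub_cancel, ← mul_assoc, ← pow_add]

/-- Both sides of the Gaussian identity factor into spherical and radial parts; the left has degree
two higher, and the ratio of the radial moments is `i + j + M`. -/
theorem sphereMoment_succ (z w : EuclideanSpace ℝ (Fin (M + 1))) (i j : ℕ) :
    ((i : ℝ) + j + M) * sphereMoment z w (i + 1) j
      = i * inner ℝ z z * sphereMoment z w (i - 1) j
        + j * inner ℝ z w * sphereMoment z w i (j - 1) := by
  have h := gaussian_integration_by_parts z w i j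
  rw [gaussian_moment_eq, gaussian_moment_eq, gaussian_moment_eq] at h
  have h0 : ((volume : Measure (EuclideanSpace ℝ (Fin (M + 1)))).toSphere Set.univ).toReal ≠ 0 :=
    ENNReal.toReal_ne_zero.2 ⟨toSphere_univ_ne_zero M, measure_ne_top _ _⟩
  set V := ((volume : Measure (EuclideanSpace ℝ (Fin (M + 1)))).toSphere Set.univ).toReal
  -- For `i = j = 0` no moment of lower degree exists to compare with; there the identity just says
  -- that the first moment vanishes.
  by_cases hij : i + j = 0
  · obtain ⟨rfl, rfl⟩ : i = 0 ∧ j = 0 := by omega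
    have := gaussianRadialMoment_pos (M + (0 + 1 + 0))
    simp only [Nat.cast_zero, zero_mul, add_zero, mul_eq_zero] at h ⊢
    rcases h with (h | h) | h
    · exact absurd h h0
    · right; exact h
    · exact absurd h this.ne'
  · obtain ⟨n, hn⟩ : ∃ n, i + j = n + 1 := ⟨i + j - 1, by omega⟩
    have e1 : M + (i + 1 + j) = (M + n) + 2 := by omega
    have e2 : (i : ℝ) * gaussianRadialMoment (M + (i - 1 + j))
        = i * gaussianRadialMoment (M + n) := by
      rcases i with _ | i
      · simp
      · congr 2; omega
    have e3 : (j : ℝ) * gaussianRadialMoment (M + (i + (j - 1)))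
        = j * gaussianRadialMoment (M + n) := by
      rcases j with _ | j
      · simp
      · congr 2; omega
    rw [e1, gaussianRadialMoment_add_two] at h
    have e4 : (i : ℝ) + j = n + 1 := by exact_mod_cast hn
    have hρ := (gaussianRadialMoment_pos (M + n)).ne'
    apply mul_left_cancel₀ (mul_ne_zero h0 hρ)
    push_cast at h
    linear_combination h + V * inner ℝ z z * sphereMoment z w (i - 1) j * e2
      + V * inner ℝ z w * sphereMoment z w i (j - 1) * e3
      + V * gaussianRadialMoment (M + n) * sphereMoment z w (i + 1) j * e4

theorem sphereMoment_comm (z w : EuclideanSpace ℝ (Fin (M + 1))) (i j : ℕ) :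
    sphereMoment z w i j = sphereMoment w z j i := by
  simp only [sphereMoment, mul_comm]

/-- Mixed moments are polynomials in the inner product, of degree at most each exponent. -/
theorem exists_sphereMoment_eq_eval (hM : 1 ≤ M) (i j : ℕ) :
    ∃ Q : ℝ[X], Q.natDegree ≤ i ∧ Q.natDegree ≤ j ∧ ∀ z w : SphereFin M,
      sphereMoment (z : EuclideanSpace ℝ (Fin (M + 1))) w i j
        = Q.eval (inner ℝ (z : EuclideanSpace ℝ (Fin (M + 1))) w) := by
  have hz : ∀ z : SphereFin M, inner ℝ (z : EuclideanSpace ℝ (Fin (M + 1)))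
      (z : EuclideanSpace ℝ (Fin (M + 1))) = 1 := fun z => by
    rw [real_inner_self_eq_norm_sq, norm_eq_of_mem_sphere z, one_pow]
  induction hn : i + j using Nat.strong_induction_on generalizing i j with
  | _ n ih =>
    have hM' : (0 : ℝ) < M := by exact_mod_cast hM
    rcases i with _ | i
    · rcases j with _ | j
      · refine ⟨1, by simp, by simp, fun z w => ?_⟩
        simp [sphereMoment]
      · rcases j with _ | j
        · refine ⟨0, by simp, by simp, fun z w => ?_⟩
          have := sphereMoment_succ (w : EuclideanSpace ℝ (Fin (M + 1))) z 0 0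
          rw [sphereMoment_comm]
          simp only [Nat.cast_zero, zero_mul, add_zero, zero_add, mul_eq_zero, hM'.ne',
            false_or] at this
          rw [zero_add, this, eval_zero]
        · obtain ⟨Q, hQ, -, h⟩ := ih j (by omega) 0 j (by omega)
          refine ⟨C (((j : ℝ) + 1) / (j + 1 + M)) * Q,
            (natDegree_C_mul_le _ _).trans hQ, (natDegree_C_mul_le _ _).trans (by omega),
            fun z w => ?_⟩
          have := sphereMoment_succ (w : EuclideanSpace ℝ (Fin (M + 1))) z (j + 1) 0
          rw [hz, sphereMoment_comm _ _ _ 0, sphereMoment_comm _ _ _ 0, Nat.add_sub_cancel,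
            h z w] at this
          push_cast at this
          rw [eval_mul, eval_C, div_mul_eq_mul_div, eq_div_iff (by positivity)]
          linarith
    · have h1 : ∃ Q : ℝ[X], Q.natDegree ≤ i + 1 ∧ Q.natDegree ≤ j ∧ ∀ z w : SphereFin M,
          i * sphereMoment (z : EuclideanSpace ℝ (Fin (M + 1))) w (i - 1) j
            = Q.eval (inner ℝ (z : EuclideanSpace ℝ (Fin (M + 1))) w) := by
        rcases i with _ | i
        · exact ⟨0, by simp, by simp, fun z w => by simp⟩
        · obtain ⟨Q, hQ, hQ', h⟩ := ih (i + j) (by omega) i j rfl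
          refine ⟨C ((i + 1 : ℕ) : ℝ) * Q, (natDegree_C_mul_le _ _).trans (by omega),
            (natDegree_C_mul_le _ _).trans hQ', fun z w => ?_⟩
          rw [Nat.add_sub_cancel, h, eval_mul, eval_C]
      have h2 : ∃ Q : ℝ[X], Q.natDegree ≤ i + 1 ∧ Q.natDegree ≤ j ∧ ∀ z w : SphereFin M,
          j * inner ℝ (z : EuclideanSpace ℝ (Fin (M + 1))) w *
            sphereMoment (z : EuclideanSpace ℝ (Fin (M + 1))) w i (j - 1)
            = Q.eval (inner ℝ (z : EuclideanSpace ℝ (Fin (M + 1))) w) := by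
        rcases j with _ | j
        · exact ⟨0, by simp, by simp, fun z w => by simp⟩
        · obtain ⟨Q, hQ, hQ', h⟩ := ih (i + j) (by omega) i j rfl
          -- The factor `X` raises the degree by one, but both exponents have dropped by one, so
          -- both degree bounds survive.
          have hd : (C ((j + 1 : ℕ) : ℝ) * X * Q).natDegree ≤ 1 + Q.natDegree :=
            (natDegree_mul_le).trans (Nat.add_le_add_right ((natDegree_C_mul_le _ _).trans natDegree_X_le) _)
          refine ⟨C ((j + 1 : ℕ) : ℝ) * X * Q, by omega, by omega, fun z w => ?_⟩
          rw [Nat.add_sub_cancel, h, eval_mul, eval_mul, eval_C, eval_X]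
      obtain ⟨Q1, a1, b1, h1⟩ := h1
      obtain ⟨Q2, a2, b2, h2⟩ := h2
      by_cases hij : (i : ℝ) + j + M = 0
      · have : (0 : ℝ) < i + j + M := by positivity
        exact absurd hij this.ne'
      refine ⟨C ((i : ℝ) + j + M)⁻¹ * (Q1 + Q2),
        (natDegree_C_mul_le _ _).trans (natDegree_add_le_of_degree_le a1 a2),
        (natDegree_C_mul_le _ _).trans (natDegree_add_le_of_degree_le b1 b2), fun z w => ?_⟩
      have := sphereMoment_succ (z : EuclideanSpace ℝ (Fin (M + 1))) w i j
      rw [hz, mul_one, h1, h2] at this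
      rw [eval_mul, eval_C, eval_add, ← this, inv_mul_cancel_left₀ hij]

end Sphere

/-! ### Integration of zonal polynomials -/

section Zonal

variable {M : ℕ}

open MeasureTheory

/-- The inner product of two points of the sphere `S^M`. -/
def sphereInner (z w : SphereFin M) : ℝ :=
  inner ℝ (z : EuclideanSpace ℝ (Fin (M + 1))) (w : EuclideanSpace ℝ (Fin (M + 1)))

theorem sphereInner_self (z : SphereFin M) : sphereInner z z = 1 := by
  rw [sphereInner, real_inner_self_eq_norm_sq, norm_eq_of_mem_sphere z, one_pow]

theorem sphereInner_comm (z w : SphereFin M) : sphereInner z w = sphereInner w z :=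
  real_inner_comm _ _

@[fun_prop]
theorem continuous_sphereInner {X : Type*} [TopologicalSpace X] {f g : X → SphereFin M}
    (hf : Continuous f) (hg : Continuous g) : Continuous fun x => sphereInner (f x) (g x) := by
  unfold sphereInner
  fun_prop

theorem abs_sphereInner_le_one (z w : SphereFin M) : |sphereInner z w| ≤ 1 := by
  have := abs_real_inner_le_norm (z : EuclideanSpace ℝ (Fin (M + 1))) w
  rwa [norm_eq_of_mem_sphere z, norm_eq_of_mem_sphere w, one_mul] at this

theorem sphereInner_mem_Icc (z w : SphereFin M) : sphereInner z w ∈ Set.Icc (-1 : ℝ) 1 :=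
  abs_le.1 (abs_sphereInner_le_one z w)

theorem sphereInner_lt_one {z w : SphereFin M} (h : z ≠ w) : sphereInner z w < 1 :=
  (inner_lt_one_iff_real_of_norm_eq_one (norm_eq_of_mem_sphere z) (norm_eq_of_mem_sphere w)).2
    fun h' => h (Subtype.ext h')

theorem integrable_sphereProb {f : SphereFin M → ℝ} (hf : Continuous f) :
    Integrable f (sphereProb M) :=
  hf.integrable_of_hasCompactSupport (HasCompactSupport.of_compactSpace f)

theorem integrable_sphereProb_prod {f : SphereFin M × SphereFin M → ℝ} (hf : Continuous f) :
    Integrable f ((sphereProb M).prod (sphereProb M)) :=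
  hf.integrable_of_hasCompactSupport (HasCompactSupport.of_compactSpace f)

/-- A base point of the sphere. -/
def sphereBase (M : ℕ) : SphereFin M := ⟨EuclideanSpace.single 0 1, by simp⟩

/-- Integration of a zonal polynomial over the sphere. -/
def zonalFunctional (M : ℕ) : ℝ[X] →ₗ[ℝ] ℝ where
  toFun p := ∫ v, p.eval (sphereInner (sphereBase M) v) ∂sphereProb M
  map_add' p q := by
    simp only [eval_add]
    exact integral_add (integrable_sphereProb (by fun_prop)) (integrable_sphereProb (by fun_prop))
  map_smul' c p := by
    simp only [eval_smul, smul_eq_mul, RingHom.id_apply]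
    exact integral_const_mul _ _

theorem zonalFunctional_one : zonalFunctional M 1 = 1 := by
  simp [zonalFunctional]

/-- Rotation invariance without rotations: a moment with second exponent `0` is a polynomial of
degree `0` in the inner product, hence the same for every `z`. -/
theorem zonalFunctional_eq (hM : 1 ≤ M) (p : ℝ[X]) (z : SphereFin M) :
    ∫ v, p.eval (sphereInner z v) ∂sphereProb M = zonalFunctional M p := by
  induction p using Polynomial.induction_on' with
  | add p q hp hq =>
    rw [map_add, ← hp, ← hq]
    simp only [eval_add]
    exact integral_add (integrable_sphereProb (by fun_prop)) (integrable_sphereProb (by fun_prop))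
  | monomial n a =>
    obtain ⟨Q, -, hQ, h⟩ := exists_sphereMoment_eq_eval hM n 0
    rw [eq_C_of_natDegree_le_zero hQ] at h
    have h1 := h z z
    have h2 := h (sphereBase M) z
    simp only [sphereMoment, pow_zero, mul_one, eval_C] at h1 h2
    simp only [zonalFunctional, LinearMap.coe_mk, AddHom.coe_mk, eval_monomial,
      integral_const_mul, sphereInner, h1, h2]

/-- The moment recursion with `j = 0`. It amounts to integration by parts against the density
proportional to `(1 - s²)^((M-2)/2)`, which never has to be introduced. -/
theorem zonalFunctional_derivative (p : ℝ[X]) :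
    zonalFunctional M ((1 - X ^ 2) * derivative p) = M * zonalFunctional M (X * p) := by
  have hm : ∀ n, zonalFunctional M (X ^ n)
      = sphereMoment (sphereBase M : EuclideanSpace ℝ (Fin (M + 1))) (sphereBase M) n 0 := by
    intro n
    simp [zonalFunctional, sphereMoment, sphereInner]
  induction p using Polynomial.induction_on' with
  | add p q hp hq => simp only [mul_add, map_add, hp, hq]
  | monomial n a =>
    have h := sphereMoment_succ (sphereBase M : EuclideanSpace ℝ (Fin (M + 1))) (sphereBase M) n 0
    have h1 : inner ℝ (sphereBase M : EuclideanSpace ℝ (Fin (M + 1))) (sphereBase M) = (1 : ℝ) :=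
      sphereInner_self _
    rw [← hm, ← hm, h1] at h
    simp only [Nat.cast_zero, add_zero, mul_one, zero_mul] at h
    have e1 : (1 - X ^ 2 : ℝ[X]) * derivative (monomial n a)
        = (a * n) • X ^ (n - 1) - (a * n) • X ^ (n + 1) := by
      rcases n with _ | n
      · simp
      · rw [derivative_monomial, ← C_mul_X_pow_eq_monomial, Nat.add_sub_cancel, smul_eq_C_mul,
          smul_eq_C_mul]
        ring
    have e2 : (X : ℝ[X]) * monomial n a = a • X ^ (n + 1) := by
      rw [← C_mul_X_pow_eq_monomial, smul_eq_C_mul]; ring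
    rw [e1, e2, map_sub, map_smul, map_smul, map_smul]
    simp only [smul_eq_mul]
    linear_combination -a * h

/-- Integrals of products of two zonal polynomials are polynomials in the inner product. -/
theorem exists_integral_zonal_mul (hM : 1 ≤ M) (p q : ℝ[X]) :
    ∃ Q : ℝ[X], Q.natDegree ≤ p.natDegree ∧ Q.natDegree ≤ q.natDegree ∧ ∀ z w : SphereFin M,
      ∫ v, p.eval (sphereInner z v) * q.eval (sphereInner w v) ∂sphereProb M
        = Q.eval (sphereInner z w) := by
  choose Q h1 h2 h using fun i j => exists_sphereMoment_eq_eval (M := M) hM i j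
  have hd : ∀ i ∈ Finset.range (p.natDegree + 1), ∀ j ∈ Finset.range (q.natDegree + 1),
      (C (p.coeff i * q.coeff j) * Q i j).natDegree ≤ p.natDegree ∧
      (C (p.coeff i * q.coeff j) * Q i j).natDegree ≤ q.natDegree := by
    intro i hi j hj
    rw [Finset.mem_range] at hi hj
    exact ⟨(natDegree_C_mul_le _ _).trans ((h1 i j).trans (by omega)),
      (natDegree_C_mul_le _ _).trans ((h2 i j).trans (by omega))⟩
  refine ⟨∑ i ∈ Finset.range (p.natDegree + 1), ∑ j ∈ Finset.range (q.natDegree + 1),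
    C (p.coeff i * q.coeff j) * Q i j,
    natDegree_sum_le_of_forall_le _ _ fun i hi => natDegree_sum_le_of_forall_le _ _
      fun j hj => (hd i hi j hj).1,
    natDegree_sum_le_of_forall_le _ _ fun i hi => natDegree_sum_le_of_forall_le _ _
      fun j hj => (hd i hi j hj).2, fun z w => ?_⟩
  have e : ∀ v, p.eval (sphereInner z v) * q.eval (sphereInner w v)
      = ∑ i ∈ Finset.range (p.natDegree + 1), ∑ j ∈ Finset.range (q.natDegree + 1),
        (p.coeff i * q.coeff j) * (sphereInner z v ^ i * sphereInner w v ^ j) := by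
    intro v
    rw [eval_eq_sum_range, eval_eq_sum_range, Finset.sum_mul_sum]
    exact Finset.sum_congr rfl fun i _ => Finset.sum_congr rfl fun j _ => by ring
  simp only [e, eval_finsetSum, eval_mul, eval_C]
  rw [integral_finsetSum _ fun i _ => integrable_sphereProb (by fun_prop)]
  refine Finset.sum_congr rfl fun i _ => ?_
  rw [integral_finsetSum _ fun i _ => integrable_sphereProb (by fun_prop)]
  refine Finset.sum_congr rfl fun j _ => ?_
  rw [integral_const_mul]
  congr 1
  exact h i j z w

end Zonal

/-! ### Ultraspherical polynomials: orthogonality, reproducing property, positivity -/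

section Ultraspherical

/-- The ultraspherical polynomials of the sphere `S^M`, normalized to be `1` at `1`. -/
def ultraspherical (M : ℕ) : ℕ → ℝ[X]
  | 0 => 1
  | 1 => X
  | n + 2 => C ((2 * (n : ℝ) + M + 1) / (n + M)) * X * ultraspherical M (n + 1)
      - C (((n : ℝ) + 1) / (n + M)) * ultraspherical M n

variable {M : ℕ}

theorem ultraspherical_add_two (hM : 1 ≤ M) (n : ℕ) :
    C ((n : ℝ) + M) * ultraspherical M (n + 2)
      = C (2 * (n : ℝ) + M + 1) * X * ultraspherical M (n + 1)
        - C ((n : ℝ) + 1) * ultraspherical M n := by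
  have : (0 : ℝ) < n + M := by
    have : (0 : ℝ) < M := by exact_mod_cast hM
    positivity
  have e : ∀ a : ℝ, (C ((n : ℝ) + M) * C (a / (n + M)) : ℝ[X]) = C a := by
    intro a; rw [← C_mul, mul_div_cancel₀ _ this.ne']
  rw [ultraspherical, mul_sub, ← mul_assoc, ← mul_assoc, ← mul_assoc, e, e]

theorem ultraspherical_eval_one (hM : 1 ≤ M) (n : ℕ) : (ultraspherical M n).eval 1 = 1 := by
  have hM' : (0 : ℝ) < M := by exact_mod_cast hM
  induction n using Nat.twoStepInduction with
  | zero => simp [ultraspherical]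
  | one => simp [ultraspherical]
  | more n h1 h2 =>
    have := congrArg (eval 1) (ultraspherical_add_two hM n)
    simp only [eval_mul, eval_sub, eval_C, eval_X, h1, h2] at this
    have h0 : (n : ℝ) + M ≠ 0 := by positivity
    apply mul_left_cancel₀ h0
    rw [this]; ring

theorem X_mul_ultraspherical_zero : X * ultraspherical M 0 = ultraspherical M 1 := by
  simp [ultraspherical]

/-- The recurrence solved for `X * R_{n+1}`. What matters later is that both coefficients are
positive. -/
theorem X_mul_ultraspherical_succ (hM : 1 ≤ M) (n : ℕ) :
    X * ultraspherical M (n + 1)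
      = C (((n : ℝ) + M) / (2 * n + M + 1)) * ultraspherical M (n + 2)
        + C (((n : ℝ) + 1) / (2 * n + M + 1)) * ultraspherical M n := by
  have h0 : (2 * (n : ℝ) + M + 1) ≠ 0 := by positivity
  have e : ∀ a : ℝ, (C (a / (2 * n + M + 1)) : ℝ[X]) = C (2 * (n : ℝ) + M + 1)⁻¹ * C a := by
    intro a; rw [← C_mul, div_eq_inv_mul]
  rw [e, e, mul_assoc, mul_assoc, ← mul_add, ultraspherical_add_two hM, sub_add_cancel, mul_assoc,
    ← mul_assoc, ← C_mul, inv_mul_cancel₀ h0, C_1, one_mul]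

theorem natDegree_ultraspherical_le (n : ℕ) : (ultraspherical M n).natDegree ≤ n := by
  induction n using Nat.twoStepInduction with
  | zero => simp [ultraspherical]
  | one => simp [ultraspherical]
  | more n h1 h2 =>
    rw [ultraspherical]
    refine (natDegree_sub_le_of_le (m := n + 2) (n := n + 2) ?_ ?_).trans (by simp)
    · refine natDegree_mul_le.trans ?_
      have := (natDegree_C_mul_le ((2 * (n : ℝ) + M + 1) / (n + M)) X).trans natDegree_X_le
      omega
    · exact (natDegree_C_mul_le _ _).trans (by omega)

/-- Together with `zonalFunctional_derivative`, this gives a second linear relation among the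
integrals, besides the recurrence itself. -/
theorem derivative_ultraspherical (hM : 1 ≤ M) (n : ℕ) :
    (1 - X ^ 2) * derivative (ultraspherical M (n + 1))
      = C ((n : ℝ) + 1) * (ultraspherical M n - X * ultraspherical M (n + 1)) := by
  have hM' : (0 : ℝ) < M := by exact_mod_cast hM
  have hC : ∀ n : ℕ, (C ((n : ℝ) + M) : ℝ[X]) ≠ 0 := by
    intro n
    rw [Ne, C_eq_zero]; positivity
  -- The recurrence has order two, so two consecutive identities are carried; the next one comes
  -- from differentiating the recurrence and multiplying by `1 - X ^ 2`.
  suffices h : ∀ n, (1 - X ^ 2) * derivative (ultraspherical M (n + 1))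
      = C ((n : ℝ) + 1) * (ultraspherical M n - X * ultraspherical M (n + 1)) ∧
      (1 - X ^ 2) * derivative (ultraspherical M (n + 2))
      = C ((n : ℝ) + 2) * (ultraspherical M (n + 1) - X * ultraspherical M (n + 2)) from (h n).1
  intro n
  induction n with
  | zero =>
    have h0 : (1 - X ^ 2) * derivative (ultraspherical M 1)
      = ultraspherical M 0 - X * ultraspherical M 1 := by
      simp [ultraspherical]; ring
    refine ⟨by simpa using h0, ?_⟩
    have r := ultraspherical_add_two hM 0
    have r' := congrArg derivative r
    have u0 : ultraspherical M 0 = 1 := rfl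
    have u1 : ultraspherical M 1 = X := rfl
    apply mul_left_cancel₀ (hC 0)
    simp only [zero_add, u0, u1, derivative_mul, derivative_sub, derivative_C, derivative_X,
      zero_mul, mul_zero, mul_one, Nat.cast_zero, sub_zero] at r r' ⊢
    simp only [map_add, map_ofNat, map_one, map_natCast] at r r' ⊢
    linear_combination (1 - X ^ 2) * r' + 2 * X * r
  | succ n ih =>
    obtain ⟨i1, i2⟩ := ih
    refine ⟨by push_cast; rw [i2]; ring_nf, ?_⟩
    have r0 := ultraspherical_add_two hM n
    have r := ultraspherical_add_two hM (n + 1)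
    have r' := congrArg derivative r
    apply mul_left_cancel₀ (hC (n + 1))
    simp only [derivative_mul, derivative_sub, derivative_C, derivative_X, zero_mul, zero_add,
      mul_one] at r'
    simp only [Nat.cast_add, Nat.cast_one, map_add, map_mul, map_ofNat, map_one,
      map_natCast] at r r' r0 i1 i2 ⊢
    linear_combination (1 - X ^ 2) * r' + (2 * (n + 1) + M + 1) * X * i2 - (n + 1 + 1) * i1
      + (n + 3) * X * r - (n + 2) * r0

variable (M) in
/-- The square norm of the ultraspherical polynomials. -/
def ultrasphericalNormSq (n : ℕ) : ℝ := zonalFunctional M (ultraspherical M n * ultraspherical M n)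

theorem zonalFunctional_C_mul (a : ℝ) (p : ℝ[X]) :
    zonalFunctional M (C a * p) = a * zonalFunctional M p := by
  rw [← smul_eq_C_mul, map_smul, smul_eq_mul]

/-- Eliminating the integral of `X * R_{n+1}` between the derivative formula and the recurrence
leaves the integral of `R_{n+2}` proportional to `n` times that of `R_n`. -/
theorem zonalFunctional_ultraspherical_succ (hM : 1 ≤ M) (n : ℕ) :
    zonalFunctional M (ultraspherical M (n + 1)) = 0 := by
  have hM' : (0 : ℝ) < M := by exact_mod_cast hM
  induction n using Nat.strong_induction_on with
  | _ n ih =>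
    rcases n with _ | n
    · have := zonalFunctional_derivative (M := M) 1
      simp only [derivative_one, mul_zero, map_zero, mul_one] at this
      rcases mul_eq_zero.1 this.symm with h | h
      · exact absurd h hM'.ne'
      · exact h
    · have h1 := zonalFunctional_derivative (M := M) (ultraspherical M (n + 1))
      rw [derivative_ultraspherical hM, zonalFunctional_C_mul, map_sub] at h1
      have h2 := congrArg (zonalFunctional M) (ultraspherical_add_two hM n)
      rw [map_sub, zonalFunctional_C_mul, zonalFunctional_C_mul, mul_assoc,
        zonalFunctional_C_mul] at h2
      -- The factor `n` is essential: for `n = 0` the integral of `R_0` is 1, not 0.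
      have h3 : (n : ℝ) * zonalFunctional M (ultraspherical M n) = 0 := by
        rcases n with _ | n
        · simp
        · rw [ih n (by omega), mul_zero]
      have a1 : (n : ℝ) + M ≠ 0 := by positivity
      have a2 : (n : ℝ) + 1 + M ≠ 0 := by positivity
      apply mul_left_cancel₀ (mul_ne_zero a1 a2)
      linear_combination (n + 1 + M) * h2 - (2 * n + M + 1) * h1 + (n + 1) * h3

/-- Each multiplication by `X` shifts the index by at most one, so fewer than `l` of them never
reach `R_0`, the only one with nonzero integral. -/
theorem zonalFunctional_X_pow_mul (hM : 1 ≤ M) (j l : ℕ) (h : j < l) :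
    zonalFunctional M (X ^ j * ultraspherical M l) = 0 := by
  induction j generalizing l with
  | zero =>
    obtain ⟨l, rfl⟩ : ∃ k, l = k + 1 := ⟨l - 1, by omega⟩
    rw [pow_zero, one_mul, zonalFunctional_ultraspherical_succ hM]
  | succ j ih =>
    obtain ⟨l, rfl⟩ : ∃ k, l = k + 1 := ⟨l - 1, by omega⟩
    rw [pow_succ, mul_assoc, X_mul_ultraspherical_succ hM, mul_add, map_add, mul_left_comm,
      zonalFunctional_C_mul, mul_left_comm, zonalFunctional_C_mul, ih _ (by omega),
      ih _ (by omega), mul_zero, mul_zero, add_zero]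

theorem zonalFunctional_mul_of_natDegree_lt (hM : 1 ≤ M) (p : ℝ[X]) (l : ℕ) (h : p.natDegree < l) :
    zonalFunctional M (p * ultraspherical M l) = 0 := by
  rw [p.as_sum_range_C_mul_X_pow, Finset.sum_mul, map_sum]
  refine Finset.sum_eq_zero fun i hi => ?_
  rw [mul_assoc, zonalFunctional_C_mul, zonalFunctional_X_pow_mul hM _ _
    (by rw [Finset.mem_range] at hi; omega), mul_zero]

theorem zonalFunctional_orthogonal (hM : 1 ≤ M) {m l : ℕ} (h : m ≠ l) :
    zonalFunctional M (ultraspherical M m * ultraspherical M l) = 0 := by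
  rcases lt_or_gt_of_ne h with h | h
  · exact zonalFunctional_mul_of_natDegree_lt hM _ _ ((natDegree_ultraspherical_le m).trans_lt h)
  · rw [mul_comm]
    exact zonalFunctional_mul_of_natDegree_lt hM _ _ ((natDegree_ultraspherical_le l).trans_lt h)

/-- Integrating `X * R_n * R_{n+1}`, with `X` absorbed in either factor, expresses one number as
positive multiples of two consecutive square norms. -/
theorem ultrasphericalNormSq_pos (hM : 1 ≤ M) (n : ℕ) : 0 < ultrasphericalNormSq M n := by
  have hM' : (0 : ℝ) < M := by exact_mod_cast hM
  induction n with
  | zero => simp [ultrasphericalNormSq, ultraspherical, zonalFunctional_one]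
  | succ n ih =>
    have h1 : zonalFunctional M (X * ultraspherical M (n + 1) * ultraspherical M n)
        = (n + 1) / (2 * n + M + 1) * ultrasphericalNormSq M n := by
      rw [X_mul_ultraspherical_succ hM, add_mul, map_add, mul_assoc, mul_assoc,
        zonalFunctional_C_mul, zonalFunctional_C_mul, zonalFunctional_orthogonal hM (by omega),
        mul_zero, zero_add, ultrasphericalNormSq]
    have h2 : ∃ a : ℝ, 0 < a ∧ zonalFunctional M (X * ultraspherical M n * ultraspherical M (n + 1))
        = a * ultrasphericalNormSq M (n + 1) := by
      rcases n with _ | n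
      · exact ⟨1, one_pos, by
          rw [X_mul_ultraspherical_zero, zero_add, ultrasphericalNormSq, one_mul]⟩
      · refine ⟨(n + M) / (2 * n + M + 1), by positivity, ?_⟩
        rw [X_mul_ultraspherical_succ hM, add_mul, map_add, mul_assoc, mul_assoc,
          zonalFunctional_C_mul, zonalFunctional_C_mul,
          zonalFunctional_orthogonal hM (m := n) (by omega), mul_zero, add_zero,
          ultrasphericalNormSq]
    obtain ⟨a, ha, h2⟩ := h2
    rw [mul_right_comm, h1] at h2
    refine pos_of_mul_pos_right (a := a) ?_ ha.le
    rw [← h2]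
    positivity

theorem exists_eq_sum_ultraspherical (hM : 1 ≤ M) (p : ℝ[X]) :
    ∃ b : ℕ →₀ ℝ, p = b.sum fun i a => C a * ultraspherical M i := by
  have hspan : p ∈ Submodule.span ℝ (Set.range (ultraspherical M)) := by
    have hX : ∀ q ∈ Submodule.span ℝ (Set.range (ultraspherical M)),
        X * q ∈ Submodule.span ℝ (Set.range (ultraspherical M)) := by
      intro q hq
      induction hq using Submodule.span_induction with
      | mem q hq =>
        obtain ⟨n, rfl⟩ := hq
        rcases n with _ | n
        · rw [X_mul_ultraspherical_zero]
          exact Submodule.subset_span ⟨1, rfl⟩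
        · rw [X_mul_ultraspherical_succ hM, ← smul_eq_C_mul, ← smul_eq_C_mul]
          exact add_mem (Submodule.smul_mem _ _ (Submodule.subset_span ⟨_, rfl⟩))
            (Submodule.smul_mem _ _ (Submodule.subset_span ⟨_, rfl⟩))
      | zero => rw [mul_zero]; exact zero_mem _
      | add x y _ _ hx hy => rw [mul_add]; exact add_mem hx hy
      | smul a x _ hx => rw [mul_smul_comm]; exact Submodule.smul_mem _ _ hx
    have hXn : ∀ n : ℕ, (X ^ n : ℝ[X]) ∈ Submodule.span ℝ (Set.range (ultraspherical M)) := by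
      intro n
      induction n with
      | zero => exact Submodule.subset_span ⟨0, by simp [ultraspherical]⟩
      | succ n ih => rw [pow_succ']; exact hX _ ih
    rw [p.as_sum_range_C_mul_X_pow]
    refine Submodule.sum_mem _ fun i _ => ?_
    rw [← smul_eq_C_mul]
    exact Submodule.smul_mem _ _ (hXn i)
  obtain ⟨b, hb⟩ := (Finsupp.mem_span_range_iff_exists_finsupp).1 hspan
  exact ⟨b, by rw [← hb]; simp only [smul_eq_C_mul]⟩

theorem zonalFunctional_sum_mul (hM : 1 ≤ M) (b : ℕ →₀ ℝ) (l : ℕ) :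
    zonalFunctional M ((b.sum fun i a => C a * ultraspherical M i) * ultraspherical M l)
      = b l * ultrasphericalNormSq M l := by
  rw [Finsupp.sum, Finset.sum_mul, map_sum]
  rw [Finset.sum_eq_single l]
  · rw [mul_assoc, zonalFunctional_C_mul, ultrasphericalNormSq]
  · intro i _ hi
    rw [mul_assoc, zonalFunctional_C_mul, zonalFunctional_orthogonal hM hi, mul_zero]
  · intro hl
    rw [Finsupp.notMem_support_iff.1 hl, C_0, zero_mul, zero_mul, map_zero]

open MeasureTheory in
/-- The reproducing property of the ultraspherical polynomials on the sphere. -/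
theorem integral_ultraspherical_mul (hM : 1 ≤ M) (l : ℕ) (z w : SphereFin M) :
    ∫ v, (ultraspherical M l).eval (sphereInner z v) * (ultraspherical M l).eval (sphereInner w v)
      ∂sphereProb M = ultrasphericalNormSq M l * (ultraspherical M l).eval (sphereInner z w) := by
  set R := ultraspherical M l with hR
  obtain ⟨Q, hQ, -, h⟩ := exists_integral_zonal_mul hM R R
  -- By Fubini, pairing `Q` with `R_m` equals pairing `R` with the convolution of `R` and `R_m`. The
  -- latter has degree at most `m < l`, so the pairing vanishes, and `Q` is left with only its `R_l`
  -- component.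
  have horth : ∀ m < l, zonalFunctional M (Q * ultraspherical M m) = 0 := by
    intro m hm
    obtain ⟨Q', -, hQ', h'⟩ := exists_integral_zonal_mul hM R (ultraspherical M m)
    calc zonalFunctional M (Q * ultraspherical M m)
        = ∫ w, Q.eval (sphereInner z w) * (ultraspherical M m).eval (sphereInner z w)
            ∂sphereProb M := by
          rw [← zonalFunctional_eq hM _ z]; simp only [eval_mul]
      _ = ∫ w, ∫ v, R.eval (sphereInner z v) * R.eval (sphereInner w v) *
            (ultraspherical M m).eval (sphereInner z w) ∂sphereProb M ∂sphereProb M := by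
          simp only [integral_mul_const, h]
      _ = ∫ v, ∫ w, R.eval (sphereInner z v) * R.eval (sphereInner w v) *
            (ultraspherical M m).eval (sphereInner z w) ∂sphereProb M ∂sphereProb M :=
          integral_integral_swap (integrable_sphereProb_prod (by unfold Function.uncurry; fun_prop))
      _ = ∫ v, (R * Q').eval (sphereInner z v) ∂sphereProb M := by
          refine integral_congr_ae (Filter.Eventually.of_forall fun v => ?_)
          simp only [mul_assoc, integral_const_mul, eval_mul]
          rw [sphereInner_comm z v, ← h' v z]
          simp only [sphereInner_comm _ v]
      _ = 0 := by
          rw [zonalFunctional_eq hM, mul_comm]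
          exact zonalFunctional_mul_of_natDegree_lt hM _ _
            ((hQ'.trans (natDegree_ultraspherical_le m)).trans_lt hm)
  obtain ⟨b, hb⟩ := exists_eq_sum_ultraspherical hM Q
  have hb0 : ∀ i, i ≠ l → b i = 0 := by
    intro i hi
    have h0 : zonalFunctional M (Q * ultraspherical M i) = 0 := by
      rcases lt_or_gt_of_ne hi with hi | hi
      · exact horth i hi
      · exact zonalFunctional_mul_of_natDegree_lt hM _ _
          ((hQ.trans (natDegree_ultraspherical_le l)).trans_lt hi)
    rw [hb, zonalFunctional_sum_mul hM] at h0
    exact (mul_eq_zero.1 h0).resolve_right (ultrasphericalNormSq_pos hM i).ne'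
  have hQR : Q = C (b l) * R := by
    rw [hb, Finsupp.sum, Finset.sum_eq_single l]
    · intro i _ hi
      rw [hb0 i hi, C_0, zero_mul]
    · intro hl
      rw [Finsupp.notMem_support_iff.1 hl, C_0, zero_mul]
  have hbl : b l = ultrasphericalNormSq M l := by
    have h1 := h z z
    rw [sphereInner_self, hQR, eval_mul, eval_C, hR, ultraspherical_eval_one hM, mul_one] at h1
    rw [← h1, ultrasphericalNormSq, ← zonalFunctional_eq hM _ z]
    simp only [eval_mul]
  rw [h, hQR, eval_mul, eval_C, hbl]

open MeasureTheory in
/-- Schur products with zonal ultraspherical matrices preserve positivity. -/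
theorem sum_mul_ultraspherical_nonneg (hM : 1 ≤ M) (l : ℕ) {ι : Type*} [Fintype ι]
    (A : ι → ι → ℝ) (hA : ∀ c : ι → ℝ, 0 ≤ ∑ i, ∑ j, c i * c j * A i j) (z : ι → SphereFin M)
    (c : ι → ℝ) :
    0 ≤ ∑ i, ∑ j, c i * c j * (A i j * (ultraspherical M l).eval (sphereInner (z i) (z j))) := by
  have hpos := ultrasphericalNormSq_pos hM l
  refine nonneg_of_mul_nonneg_right (a := ultrasphericalNormSq M l) ?_ hpos
  -- For fixed `v` the rank-one factor `R_l(z i · v) R_l(z j · v)` is absorbed into the coefficients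
  -- of the form of `A`.
  have e : ultrasphericalNormSq M l *
      ∑ i, ∑ j, c i * c j * (A i j * (ultraspherical M l).eval (sphereInner (z i) (z j)))
      = ∫ v, ∑ i, ∑ j, (c i * (ultraspherical M l).eval (sphereInner (z i) v)) *
          (c j * (ultraspherical M l).eval (sphereInner (z j) v)) * A i j ∂sphereProb M := by
    rw [integral_finsetSum _ fun i _ => integrable_sphereProb (by fun_prop), Finset.mul_sum]
    refine Finset.sum_congr rfl fun i _ => ?_
    rw [integral_finsetSum _ fun i _ => integrable_sphereProb (by fun_prop), Finset.mul_sum]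
    refine Finset.sum_congr rfl fun j _ => ?_
    have : ∀ v, (c i * (ultraspherical M l).eval (sphereInner (z i) v)) *
          (c j * (ultraspherical M l).eval (sphereInner (z j) v)) * A i j
        = (c i * c j * A i j) * ((ultraspherical M l).eval (sphereInner (z i) v) *
          (ultraspherical M l).eval (sphereInner (z j) v)) := fun v => by ring
    simp only [this]
    rw [integral_const_mul, integral_ultraspherical_mul hM]
    ring
  rw [e]
  exact integral_nonneg fun v => hA _

/-- Positivity of the quadratic form on the two points `z`, `w` with coefficients `1` and `±1`. -/
theorem abs_ultraspherical_le_one (hM : 1 ≤ M) (l : ℕ) (z w : SphereFin M) :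
    |(ultraspherical M l).eval (sphereInner z w)| ≤ 1 := by
  have h : ∀ ε : ℝ, ε * ε = 1 → 0 ≤ 2 + 2 * ε * (ultraspherical M l).eval (sphereInner z w) := by
    intro ε hε
    have h1 := sum_mul_ultraspherical_nonneg hM l (ι := Fin 2) (fun _ _ => 1)
      (fun c => by
        have : ∑ i, ∑ j, c i * c j * 1 = (∑ i, c i) * ∑ i, c i := by
          rw [Finset.sum_mul_sum]; simp only [mul_one]
        rw [this]; exact mul_self_nonneg _) ![z, w] ![1, ε]
    simp [Fin.sum_univ_two, sphereInner_self, ultraspherical_eval_one hM,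
      sphereInner_comm w z, hε] at h1
    linarith
  rw [abs_le]
  constructor
  · linarith [h 1 (by norm_num)]
  · linarith [h (-1) (by norm_num)]

/-- Multiplication by `1 + X` sends each `R_l` to a combination of ultraspherical polynomials with
nonnegative coefficients, so positivity propagates in `n`. -/
theorem zonalFunctional_one_add_X_pow_mul_nonneg (hM : 1 ≤ M) (n l : ℕ) :
    0 ≤ zonalFunctional M ((1 + X) ^ n * ultraspherical M l) := by
  induction n generalizing l with
  | zero =>
    rw [pow_zero, one_mul]
    rcases l with _ | l
    · simp [ultraspherical, zonalFunctional_one]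
    · rw [zonalFunctional_ultraspherical_succ hM]
  | succ n ih =>
    rw [pow_succ, mul_assoc, add_mul, one_mul, mul_add, map_add]
    refine add_nonneg (ih l) ?_
    rcases l with _ | l
    · rw [X_mul_ultraspherical_zero]; exact ih 1
    · rw [X_mul_ultraspherical_succ hM, mul_add, map_add, mul_left_comm, zonalFunctional_C_mul,
        mul_left_comm ((1 + X) ^ n), zonalFunctional_C_mul]
      exact add_nonneg (mul_nonneg (by positivity) (ih _)) (mul_nonneg (by positivity) (ih _))

-- The normalized weights `(1 + ⟪e,v⟫)^n` concentrate at their unique maximum `v = e`, where `R_l`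
-- takes the value 1.
open MeasureTheory Filter Topology in
theorem tendsto_zonalFunctional_one_add_X_pow (hM : 1 ≤ M) (l : ℕ) :
    Tendsto (fun n : ℕ => (zonalFunctional M ((1 + X) ^ n))⁻¹ *
      zonalFunctional M ((1 + X) ^ n * ultraspherical M l)) atTop (𝓝 1) := by
  have h := tendsto_setIntegral_pow_smul_of_unique_maximum_of_isCompact_of_continuousOn
    (μ := sphereProb M) (s := Set.univ) (x₀ := sphereBase M)
    (c := fun v => 1 + sphereInner (sphereBase M) v)
    (g := fun v => (ultraspherical M l).eval (sphereInner (sphereBase M) v)) isCompact_univ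
    (by fun_prop) (fun y _ hy => by
      rw [sphereInner_self]
      have := sphereInner_lt_one hy.symm
      linarith)
    (fun v _ => by linarith [(sphereInner_mem_Icc (sphereBase M) v).1])
    (by rw [sphereInner_self]; norm_num) (by simp) (by fun_prop)
  rw [sphereInner_self, ultraspherical_eval_one hM] at h
  simpa [zonalFunctional] using h

theorem zonalFunctional_one_add_X_pow_pos (hM : 1 ≤ M) (n : ℕ) :
    0 < zonalFunctional M ((1 + X) ^ n) := by
  induction n with
  | zero => rw [pow_zero, zonalFunctional_one]; exact one_pos
  | succ n ih =>
    have := zonalFunctional_one_add_X_pow_mul_nonneg hM n 1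
    rw [ultraspherical] at this
    rw [pow_succ, mul_add, mul_one, map_add]
    linarith

/-! ### Identification with the normalized Gegenbauer and Chebyshev polynomials -/

theorem gegenbauer_eval_one_succ {a : ℝ} (n : ℕ) :
    ((n : ℝ) + 1) * (gegenbauer a (n + 1)).eval 1 = (n + 2 * a) * (gegenbauer a n).eval 1 := by
  induction n with
  | zero => simp [gegenbauer]
  | succ n ih =>
    rw [gegenbauer]
    simp only [eval_sub, eval_mul, eval_C, eval_X, mul_one]
    have h : (n : ℝ) + 2 ≠ 0 := by positivity
    have e : ∀ A B x y : ℝ, ((n : ℝ) + 1 + 1) * (A / (n + 2) * x - B / (n + 2) * y)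
        = A * x - B * y := by
      intro A B x y
      field_simp
      ring
    push_cast
    rw [e]
    linear_combination ih

theorem gegenbauer_eval_one_pos {a : ℝ} (ha : 0 < a) (n : ℕ) : 0 < (gegenbauer a n).eval 1 := by
  induction n with
  | zero => simp [gegenbauer]
  | succ n ih =>
    have := gegenbauer_eval_one_succ (a := a) n
    refine pos_of_mul_pos_right (a := (n : ℝ) + 1) ?_ (by positivity)
    rw [this]
    positivity

/-- At 1 the Gegenbauer recurrence reduces to first order; dividing by these values turns it into
the recurrence of `ultraspherical`. The circle, with parameter 0, is handled separately by Chebyshev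
polynomials. -/
theorem gegenbauer_eq_C_mul_ultraspherical (hM : 2 ≤ M) (n : ℕ) :
    gegenbauer (((M : ℝ) - 1) / 2) n
      = C ((gegenbauer (((M : ℝ) - 1) / 2) n).eval 1) * ultraspherical M n := by
  have hM' : (2 : ℝ) ≤ M := by exact_mod_cast hM
  induction n using Nat.twoStepInduction with
  | zero => simp [gegenbauer, ultraspherical]
  | one => simp [gegenbauer, ultraspherical]
  | more n h1 h2 =>
    have a1 := gegenbauer_eval_one_succ (a := ((M : ℝ) - 1) / 2) n
    have a2 := gegenbauer_eval_one_succ (a := ((M : ℝ) - 1) / 2) (n + 1)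
    set g : ℕ → ℝ := fun n => (gegenbauer (((M : ℝ) - 1) / 2) n).eval 1 with hg
    change _ = C (g (n + 2)) * _
    change _ * g (n + 1) = _ * g n at a1
    change _ * g (n + 2) = _ * g (n + 1) at a2
    change _ = C (g n) * _ at h1
    change _ = C (g (n + 1)) * _ at h2
    have hn : (n : ℝ) + 2 ≠ 0 := by positivity
    have hnM : (n : ℝ) + M ≠ 0 := by positivity
    push_cast at a2
    rw [gegenbauer, h1, h2, ultraspherical]
    have b1 : g (n + 2) = ((n : ℝ) + M) / (n + 2) * g (n + 1) := by
      field_simp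
      linear_combination a2
    have b2 : ((n : ℝ) + 2 * (((M : ℝ) - 1) / 2)) * g n = (n + 1) * g (n + 1) := a1.symm
    have c1 : 2 * ((n : ℝ) + 1 + ((M : ℝ) - 1) / 2) / (n + 2) * g (n + 1)
        = g (n + 2) * ((2 * n + M + 1) / (n + M)) := by
      rw [b1]; field_simp; ring
    have c2 : ((n : ℝ) + 2 * (((M : ℝ) - 1) / 2)) / (n + 2) * g n
        = g (n + 2) * ((n + 1) / (n + M)) := by
      rw [div_mul_eq_mul_div, b2, b1]; field_simp
    have d1 := congrArg (C : ℝ → ℝ[X]) c1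
    have d2 := congrArg (C : ℝ → ℝ[X]) c2
    rw [C_mul, C_mul] at d1 d2
    linear_combination X * ultraspherical M (n + 1) * d1 - ultraspherical M n * d2

theorem chebyshev_eq_ultraspherical (n : ℕ) :
    Polynomial.Chebyshev.T ℝ (n : ℤ) = ultraspherical 1 n := by
  induction n using Nat.twoStepInduction with
  | zero => simp [ultraspherical]
  | one => simp [ultraspherical]
  | more n h1 h2 =>
    have : (n : ℝ) + 1 ≠ 0 := by positivity
    have e1 : (2 * (n : ℝ) + (1 : ℕ) + 1) / (n + (1 : ℕ)) = 2 := by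
      push_cast; field_simp; ring
    have e2 : ((n : ℝ) + 1) / (n + (1 : ℕ)) = 1 := by
      push_cast; field_simp
    rw [ultraspherical, e1, e2, ← h1, ← h2]
    push_cast
    rw [Polynomial.Chebyshev.T_add_two]
    simp only [map_ofNat, map_one, one_mul]

theorem normalizedGegenbauer_eq (hM : 1 ≤ M) (l : ℕ) (s : ℝ) :
    normalizedGegenbauer M l s = (ultraspherical M l).eval s := by
  unfold normalizedGegenbauer sphereGegenbauer
  by_cases h : M = 1
  · subst h
    simp only [if_true, chebyshev_eq_ultraspherical]
    rw [ultraspherical_eval_one le_rfl, div_one]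
  · have hM2 : 2 ≤ M := by omega
    have hM' : (2 : ℝ) ≤ M := by exact_mod_cast hM2
    rw [if_neg h]
    have h1 := gegenbauer_eval_one_pos (a := ((M : ℝ) - 1) / 2) (by linarith) l
    have h2 := congrArg (eval s) (gegenbauer_eq_C_mul_ultraspherical hM2 l)
    rw [eval_mul, eval_C] at h2
    rw [h2, mul_div_cancel_left₀ _ h1.ne']

end Ultraspherical

/-! ### From finite quadratic forms to integrals -/

section IntegratedPositivity

open MeasureTheory ProbabilityTheory

/-- Sample `n` independent points from `σ` and take the expectation of the double sum. Off-diagonal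
pairs contribute order `n²` times the double integral, the diagonal only order `n`, so a negative
double integral is impossible. -/
theorem integral_prod_nonneg_of_positive_definite {X : Type*} [MeasurableSpace X] (σ : Measure X)
    [IsProbabilityMeasure σ] (k : X × X → ℝ) (hk : Integrable k (σ.prod σ))
    (hkd : Integrable (fun z => k (z, z)) σ)
    (hpos : ∀ (n : ℕ) (z : Fin n → X), 0 ≤ ∑ i, ∑ j, k (z i, z j)) :
    0 ≤ ∫ p, k p ∂σ.prod σ := by
  set J := ∫ p, k p ∂σ.prod σ
  set B := ∫ z, k (z, z) ∂σ
  have hpair : ∀ (n : ℕ) (i j : Fin n), i ≠ j →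
      MeasurePreserving (fun ω : Fin n → X => (ω i, ω j)) (Measure.pi fun _ => σ) (σ.prod σ) := by
    intro n i j hij
    refine ⟨by fun_prop, ?_⟩
    have h1 := (iIndepFun_pi (μ := fun _ : Fin n => σ) (X := fun _ x => x)
      (fun _ => aemeasurable_id)).indepFun hij
    rw [indepFun_iff_map_prod_eq_prod_map_map (measurable_pi_apply i).aemeasurable
      (measurable_pi_apply j).aemeasurable] at h1
    rw [h1]
    congr 1
    · exact (measurePreserving_eval (fun _ : Fin n => σ) i).map_eq
    · exact (measurePreserving_eval (fun _ : Fin n => σ) j).map_eq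
  have hint : ∀ (n : ℕ) (i j : Fin n),
      Integrable (fun ω : Fin n → X => k (ω i, ω j)) (Measure.pi fun _ => σ) ∧
      ∫ ω : Fin n → X, k (ω i, ω j) ∂(Measure.pi fun _ => σ) = if i = j then B else J := by
    intro n i j
    by_cases hij : i = j
    · subst hij
      have h := measurePreserving_eval (fun _ : Fin n => σ) i
      refine ⟨h.integrable_comp_of_integrable hkd, ?_⟩
      rw [if_pos rfl]
      have h2 := integral_map (μ := Measure.pi fun _ : Fin n => σ) h.measurable.aemeasurable
        (f := fun z => k (z, z)) (by rw [h.map_eq]; exact hkd.aestronglyMeasurable)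
      rw [h.map_eq] at h2
      exact h2.symm
    · have h := hpair n i j hij
      refine ⟨h.integrable_comp_of_integrable hk, ?_⟩
      rw [if_neg hij]
      have h2 := integral_map (μ := Measure.pi fun _ : Fin n => σ) h.measurable.aemeasurable
        (f := k) (by rw [h.map_eq]; exact hk.aestronglyMeasurable)
      rw [h.map_eq] at h2
      exact h2.symm
  have hn : ∀ n : ℕ, 0 ≤ (n + 1 : ℝ) * (B - J) + (n + 1) ^ 2 * J := by
    intro n
    have h1 : 0 ≤ ∫ ω : Fin (n + 1) → X, ∑ i, ∑ j, k (ω i, ω j) ∂(Measure.pi fun _ => σ) :=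
      integral_nonneg fun ω => hpos _ ω
    rw [integral_finsetSum _ fun i _ => integrable_finsetSum _ fun j _ => (hint _ i j).1] at h1
    simp only [integral_finsetSum _ fun j _ => (hint _ _ j).1, (hint _ _ _).2] at h1
    have h2 : ∀ i j : Fin (n + 1), (if i = j then B else J) = (if i = j then B - J else 0) + J := by
      intro i j; split_ifs <;> ring
    simp only [h2, Finset.sum_add_distrib, Finset.sum_ite_eq, Finset.mem_univ, if_true,
      Finset.sum_const, Finset.card_univ, Fintype.card_fin, nsmul_eq_mul] at h1
    push_cast at h1
    linarith
  by_contra hJ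
  push Not at hJ
  obtain ⟨n, hn'⟩ := exists_nat_gt ((B - J) / (-J))
  rw [div_lt_iff₀ (by linarith)] at hn'
  have h := hn n
  have : (n + 1 : ℝ) * (B - J) + (n + 1) ^ 2 * J = (n + 1) * ((B - J) + (n + 1) * J) := by ring
  rw [this] at h
  have h2 : 0 ≤ (B - J) + (n + 1) * J := nonneg_of_mul_nonneg_right h (by positivity)
  linarith

end IntegratedPositivity

/-! ### Ultraspherical coefficients of zonal functions -/

section ZonalCoefficients

open MeasureTheory

variable {M : ℕ}

variable (M) in
/-- Integration over pairs of points of the sphere. -/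
abbrev spherePairs : Measure (SphereFin M × SphereFin M) := (sphereProb M).prod (sphereProb M)

variable (M) in
/-- The coefficient of a zonal function against an ultraspherical polynomial. -/
def zonalCoeff (φ : ℝ → ℝ) (l : ℕ) : ℝ :=
  ∫ p, φ (sphereInner p.1 p.2) * (ultraspherical M l).eval (sphereInner p.1 p.2) ∂spherePairs M

theorem integral_spherePairs_eval (hM : 1 ≤ M) (p : ℝ[X]) :
    ∫ x, p.eval (sphereInner x.1 x.2) ∂spherePairs M = zonalFunctional M p := by
  rw [integral_prod _ (integrable_sphereProb_prod (by fun_prop))]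
  simp only [zonalFunctional_eq hM, integral_const, probReal_univ, one_smul]

theorem continuous_comp_sphereInner {φ : ℝ → ℝ} (hφ : ContinuousOn φ (Set.Icc (-1) 1)) :
    Continuous fun x : SphereFin M × SphereFin M => φ (sphereInner x.1 x.2) :=
  hφ.comp_continuous (f := fun x : SphereFin M × SphereFin M => sphereInner x.1 x.2)
    (by fun_prop) fun x => sphereInner_mem_Icc x.1 x.2

theorem integral_mul_eval_eq_sum (φ : ℝ → ℝ) (hφ : ContinuousOn φ (Set.Icc (-1) 1)) (b : ℕ →₀ ℝ) :
    ∫ x, φ (sphereInner x.1 x.2) *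
      (b.sum fun i a => C a * ultraspherical M i).eval (sphereInner x.1 x.2) ∂spherePairs M
      = b.sum fun i a => a * zonalCoeff M φ i := by
  have hc := continuous_comp_sphereInner (M := M) hφ
  have e : ∀ x : SphereFin M × SphereFin M, φ (sphereInner x.1 x.2) *
      (b.sum fun i a => C a * ultraspherical M i).eval (sphereInner x.1 x.2)
      = ∑ i ∈ b.support, b i * (φ (sphereInner x.1 x.2) *
        (ultraspherical M i).eval (sphereInner x.1 x.2)) := by
    intro x
    rw [Finsupp.sum, eval_finsetSum, Finset.mul_sum]
    refine Finset.sum_congr rfl fun i _ => ?_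
    rw [eval_mul, eval_C]; ring
  have hi : ∀ i, Continuous fun x : SphereFin M × SphereFin M => b i *
      (φ (sphereInner x.1 x.2) * (ultraspherical M i).eval (sphereInner x.1 x.2)) := fun i =>
    continuous_const.mul (hc.mul (by fun_prop))
  simp only [e]
  rw [integral_finsetSum _ fun i _ => integrable_sphereProb_prod (hi i)]
  simp only [integral_const_mul]
  rfl

/-- Such a `φ` is orthogonal to every polynomial, hence by Weierstrass to itself; a continuous
function of zero square integral vanishes because the measure charges every nonempty open set. -/
theorem eq_zero_of_zonalCoeff_eq_zero (hM : 1 ≤ M) {φ : ℝ → ℝ}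
    (hφ : ContinuousOn φ (Set.Icc (-1) 1)) (h : ∀ l, zonalCoeff M φ l = 0) (z w : SphereFin M) :
    φ (sphereInner z w) = 0 := by
  have hc := continuous_comp_sphereInner (M := M) hφ
  have hpoly : ∀ p : ℝ[X],
      ∫ x, φ (sphereInner x.1 x.2) * p.eval (sphereInner x.1 x.2) ∂spherePairs M = 0 := by
    intro p
    obtain ⟨b, rfl⟩ := exists_eq_sum_ultraspherical hM p
    rw [integral_mul_eval_eq_sum φ hφ]
    simp [h]
  set I := ∫ x, |φ (sphereInner x.1 x.2)| ∂spherePairs M with hI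
  have hI0 : 0 ≤ I := integral_nonneg fun _ => abs_nonneg _
  have hsq : ∀ ε > 0, ∫ x, φ (sphereInner x.1 x.2) * φ (sphereInner x.1 x.2) ∂spherePairs M
      ≤ I * ε := by
    intro ε hε
    obtain ⟨p, hp⟩ := exists_polynomial_near_of_continuousOn _ _ φ hφ ε hε
    have e : ∀ x : SphereFin M × SphereFin M, φ (sphereInner x.1 x.2) * φ (sphereInner x.1 x.2)
        = φ (sphereInner x.1 x.2) * p.eval (sphereInner x.1 x.2) + φ (sphereInner x.1 x.2) *
          (φ (sphereInner x.1 x.2) - p.eval (sphereInner x.1 x.2)) := fun x => by ring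
    have h1 : Continuous fun x : SphereFin M × SphereFin M =>
        φ (sphereInner x.1 x.2) * p.eval (sphereInner x.1 x.2) := hc.mul (by fun_prop)
    have h2 : Continuous fun x : SphereFin M × SphereFin M => φ (sphereInner x.1 x.2) *
        (φ (sphereInner x.1 x.2) - p.eval (sphereInner x.1 x.2)) := hc.mul (hc.sub (by fun_prop))
    simp only [e]
    rw [integral_add (integrable_sphereProb_prod h1) (integrable_sphereProb_prod h2), hpoly,
      zero_add, hI, ← integral_mul_const]
    refine integral_mono (integrable_sphereProb_prod h2)
      (integrable_sphereProb_prod (hc.abs.mul continuous_const)) fun x => ?_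
    refine (le_abs_self _).trans ?_
    rw [abs_mul, abs_sub_comm]
    exact mul_le_mul_of_nonneg_left (hp _ (sphereInner_mem_Icc _ _)).le (abs_nonneg _)
  have hle : ∫ x, φ (sphereInner x.1 x.2) * φ (sphereInner x.1 x.2) ∂spherePairs M ≤ 0 := by
    refine le_of_forall_pos_le_add fun ε hε => ?_
    rw [zero_add]
    refine (hsq (ε / (I + 1)) (by positivity)).trans ?_
    rw [← mul_div_assoc, div_le_iff₀ (by positivity)]
    nlinarith
  have h0 := hle.antisymm (integral_nonneg fun x => mul_self_nonneg _)
  rw [integral_eq_zero_iff_of_nonneg (fun x => mul_self_nonneg _)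
    (integrable_sphereProb_prod (hc.mul hc))] at h0
  have h1 := (Continuous.ae_eq_iff_eq (spherePairs M) (hc.mul hc) continuous_const).1 h0
  exact mul_self_eq_zero.1 (congrFun h1 (z, w))

/-- The coefficients of a bounded zonal function with nonnegative coefficients are summable. -/
theorem sum_zonalCoeff_le (hM : 1 ≤ M) {φ : ℝ → ℝ} (hφ : ContinuousOn φ (Set.Icc (-1) 1)) {B : ℝ}
    (hB : ∀ s ∈ Set.Icc (-1 : ℝ) 1, φ s ≤ B) (h : ∀ l, 0 ≤ zonalCoeff M φ l) (A : Finset ℕ) :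
    ∑ l ∈ A, zonalCoeff M φ l / ultrasphericalNormSq M l ≤ B := by
  have hc := continuous_comp_sphereInner (M := M) hφ
  -- The multipliers are the normalized coefficients of `(1 + X) ^ n`: nonnegative, and tending to 1
  -- as `n` grows.
  have key : ∀ n : ℕ, ∑ l ∈ A, (zonalFunctional M ((1 + X) ^ n))⁻¹ *
      zonalFunctional M ((1 + X) ^ n * ultraspherical M l) *
      (zonalCoeff M φ l / ultrasphericalNormSq M l) ≤ B := by
    intro n
    have hT := zonalFunctional_one_add_X_pow_pos hM n
    obtain ⟨b, hb⟩ := exists_eq_sum_ultraspherical hM ((1 + X) ^ n)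
    have hbl : ∀ l, zonalFunctional M ((1 + X) ^ n * ultraspherical M l)
        = b l * ultrasphericalNormSq M l := by
      intro l
      rw [hb, zonalFunctional_sum_mul hM]
    have hb0 : ∀ l, 0 ≤ b l := fun l =>
      nonneg_of_mul_nonneg_left (by rw [← hbl]; exact zonalFunctional_one_add_X_pow_mul_nonneg hM n l)
        (ultrasphericalNormSq_pos hM l)
    have e : ∀ l, (zonalFunctional M ((1 + X) ^ n))⁻¹ *
        zonalFunctional M ((1 + X) ^ n * ultraspherical M l) *
        (zonalCoeff M φ l / ultrasphericalNormSq M l)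
        = (zonalFunctional M ((1 + X) ^ n))⁻¹ * (b l * zonalCoeff M φ l) := by
      intro l
      have := (ultrasphericalNormSq_pos hM l).ne'
      rw [hbl]
      field_simp
    simp only [e, ← Finset.mul_sum]
    rw [inv_mul_le_iff₀ hT]
    -- All terms are nonnegative, so enlarging `A` to contain the support of `b` turns the partial
    -- sum into an upper bound that is a genuine integral.
    calc ∑ l ∈ A, b l * zonalCoeff M φ l
        ≤ ∑ l ∈ A ∪ b.support, b l * zonalCoeff M φ l :=
          Finset.sum_le_sum_of_subset_of_nonneg Finset.subset_union_left
            fun l _ _ => mul_nonneg (hb0 l) (h l)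
      _ = b.sum fun i a => a * zonalCoeff M φ i := by
          refine (Finset.sum_subset Finset.subset_union_right fun l _ hl => ?_).symm
          rw [Finsupp.notMem_support_iff.1 hl, zero_mul]
      _ = ∫ x, φ (sphereInner x.1 x.2) * ((1 + X) ^ n : ℝ[X]).eval (sphereInner x.1 x.2)
            ∂spherePairs M := by
          rw [← integral_mul_eval_eq_sum φ hφ, ← hb]
      _ ≤ ∫ x, B * ((1 + X) ^ n : ℝ[X]).eval (sphereInner x.1 x.2) ∂spherePairs M := by
          refine integral_mono (integrable_sphereProb_prod (hc.mul (by fun_prop)))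
            (integrable_sphereProb_prod (by fun_prop)) fun x => ?_
          refine mul_le_mul_of_nonneg_right (hB _ (sphereInner_mem_Icc _ _)) ?_
          have := (sphereInner_mem_Icc x.1 x.2).1
          simp only [eval_pow, eval_add, eval_one, eval_X]
          exact pow_nonneg (by linarith) _
      _ = zonalFunctional M ((1 + X) ^ n) * B := by
          rw [integral_const_mul, integral_spherePairs_eval hM, mul_comm]
  have hlim := tendsto_finsetSum A fun l _ =>
    (tendsto_zonalFunctional_one_add_X_pow hM l).mul_const
      (zonalCoeff M φ l / ultrasphericalNormSq M l)
  simp only [one_mul] at hlim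
  exact le_of_tendsto hlim (Filter.Eventually.of_forall key)

theorem zonalCoeff_ultraspherical (hM : 1 ≤ M) (l m : ℕ) :
    zonalCoeff M (fun s => (ultraspherical M l).eval s) m
      = if l = m then ultrasphericalNormSq M m else 0 := by
  have : zonalCoeff M (fun s => (ultraspherical M l).eval s) m
      = zonalFunctional M (ultraspherical M l * ultraspherical M m) := by
    rw [zonalCoeff, ← integral_spherePairs_eval hM]
    simp only [eval_mul]
  rw [this]
  split_ifs with h
  · rw [h, ultrasphericalNormSq]
  · exact zonalFunctional_orthogonal hM h

theorem continuous_zonalCoeff {F : ℝ → ℝ → ℝ} (hF : Continuous (Function.uncurry F)) (l : ℕ) :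
    Continuous fun t => zonalCoeff M (F t) l := by
  unfold zonalCoeff
  have h : Continuous (Function.uncurry fun (t : ℝ) (x : SphereFin M × SphereFin M) =>
      F t (sphereInner x.1 x.2) * (ultraspherical M l).eval (sphereInner x.1 x.2)) := by
    have h1 : Continuous fun q : ℝ × (SphereFin M × SphereFin M) =>
        F q.1 (sphereInner q.2.1 q.2.2) :=
      hF.comp (f := fun q : ℝ × (SphereFin M × SphereFin M) => (q.1, sphereInner q.2.1 q.2.2))
        (by fun_prop)
    unfold Function.uncurry
    exact h1.mul (by fun_prop)
  simpa using continuous_parametric_integral_of_continuous (μ := spherePairs M) h isCompact_univ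

/-- The quadratic form at the points `x i` is a double integral over the sphere. Its finite sampled
sums are quadratic forms of `F` times `R_l` on the product family `(x i, z a)`, nonnegative by the
Schur argument. -/
theorem zonalCoeff_positive_definite (hM : 1 ≤ M) {F : ℝ → ℝ → ℝ}
    (hF : Continuous (Function.uncurry F))
    (hpd : IsPositiveDefiniteKernel fun p q : SphereInf × SphereFin M =>
      F (inner ℝ (p.1 : lp (fun _ : ℕ => ℝ) 2) (q.1 : lp (fun _ : ℕ => ℝ) 2))
        (sphereInner p.2 q.2)) (l : ℕ) :
    IsPositiveDefiniteKernel fun x y : SphereInf =>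
      zonalCoeff M (F (inner ℝ (x : lp (fun _ : ℕ => ℝ) 2) (y : lp (fun _ : ℕ => ℝ) 2))) l := by
  intro n x _ c
  have hFt : ∀ t, Continuous (F t) := fun t =>
    hF.comp (f := fun s : ℝ => (t, s)) (by fun_prop)
  set T : Fin n → Fin n → ℝ := fun i j =>
    inner ℝ (x i : lp (fun _ : ℕ => ℝ) 2) (x j : lp (fun _ : ℕ => ℝ) 2) with hT
  have hc : ∀ i j, Continuous fun p : SphereFin M × SphereFin M => F (T i j) (sphereInner p.1 p.2) :=
    fun i j => continuous_comp_sphereInner (hFt (T i j)).continuousOn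
  have e : ∑ i, ∑ j, c i * c j * zonalCoeff M (F (T i j)) l
      = ∫ p, ∑ i, ∑ j, c i * c j * (F (T i j) (sphereInner p.1 p.2) *
          (ultraspherical M l).eval (sphereInner p.1 p.2)) ∂spherePairs M := by
    have hi : ∀ i j, Continuous fun p : SphereFin M × SphereFin M =>
        c i * c j * (F (T i j) (sphereInner p.1 p.2) *
          (ultraspherical M l).eval (sphereInner p.1 p.2)) := fun i j =>
      continuous_const.mul ((hc i j).mul (by fun_prop))
    rw [integral_finsetSum _ fun i _ => integrable_sphereProb_prod
      (continuous_finsetSum _ fun j _ => hi i j)]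
    refine Finset.sum_congr rfl fun i _ => ?_
    rw [integral_finsetSum _ fun j _ => integrable_sphereProb_prod (hi i j)]
    refine Finset.sum_congr rfl fun j _ => ?_
    rw [integral_const_mul]
    rfl
  change 0 ≤ ∑ i, ∑ j, c i * c j * zonalCoeff M (F (T i j)) l
  rw [e]
  have hk : Continuous fun p : SphereFin M × SphereFin M => ∑ i, ∑ j, c i * c j *
      (F (T i j) (sphereInner p.1 p.2) * (ultraspherical M l).eval (sphereInner p.1 p.2)) :=
    continuous_finsetSum _ fun i _ => continuous_finsetSum _ fun j _ =>
      continuous_const.mul ((hc i j).mul (by fun_prop))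
  refine integral_prod_nonneg_of_positive_definite (sphereProb M) _
    (integrable_sphereProb_prod hk)
    (integrable_sphereProb (hk.comp (f := fun z => (z, z)) (by fun_prop))) fun m z => ?_
  -- The sampled points may coincide, so positivity is needed for families with repetitions; the
  -- coefficients ignore the sampling index.
  have h := sum_mul_ultraspherical_nonneg hM l (ι := Fin m × Fin n)
    (fun a b => F (T a.2 b.2) (sphereInner (z a.1) (z b.1)))
    (fun c => hpd.sum_nonneg (fun a : Fin m × Fin n => (x a.2, z a.1)) c)
    (fun a => z a.1) (fun a => c a.2)
  refine h.trans_eq ?_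
  simp only [Fintype.sum_prod_type]
  refine Finset.sum_congr rfl fun p _ => ?_
  rw [Finset.sum_comm]

end ZonalCoefficients

/-! ### Great circles realizing every inner product -/

section Path

/-- A great circle in the unit sphere. -/
theorem exists_great_circle {H : Type*} [NormedAddCommGroup H] [InnerProductSpace ℝ H] (e : Fin 2 → H)
    (he : Orthonormal ℝ e) : ∃ (x : Metric.sphere (0 : H) 1) (γ : ℝ → Metric.sphere (0 : H) 1),
      Continuous γ ∧ ∀ θ, inner ℝ (x : H) (γ θ : H) = Real.cos θ := by
  have h0 : inner ℝ (e 0) (e 0) = (1 : ℝ) := by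
    rw [real_inner_self_eq_norm_sq, he.1, one_pow]
  have h1 : inner ℝ (e 1) (e 1) = (1 : ℝ) := by
    rw [real_inner_self_eq_norm_sq, he.1, one_pow]
  have h01 : inner ℝ (e 0) (e 1) = (0 : ℝ) := he.2 (by decide)
  have h10 : inner ℝ (e 1) (e 0) = (0 : ℝ) := he.2 (by decide)
  have hn : ∀ θ, Real.cos θ • e 0 + Real.sin θ • e 1 ∈ Metric.sphere (0 : H) 1 := by
    intro θ
    rw [mem_sphere_zero_iff_norm, ← sq_eq_sq₀ (norm_nonneg _) zero_le_one,
      ← real_inner_self_eq_norm_sq]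
    simp only [inner_add_left, inner_add_right, real_inner_smul_left, real_inner_smul_right,
      h0, h1, h01, h10]
    linear_combination Real.sin_sq_add_cos_sq θ
  refine ⟨⟨e 0, by simp [he.1]⟩, fun θ => ⟨_, hn θ⟩, by fun_prop, fun θ => ?_⟩
  simp only [inner_add_right, real_inner_smul_right, h0, h01]
  ring

theorem exists_great_circle_sphereInf : ∃ (x : SphereInf) (γ : ℝ → SphereInf),
    Continuous γ ∧ ∀ θ, inner ℝ (x : lp (fun _ : ℕ => ℝ) 2) (γ θ : lp (fun _ : ℕ => ℝ) 2)
      = Real.cos θ := by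
  refine exists_great_circle (fun i : Fin 2 => lp.single 2 (i : ℕ) (1 : ℝ)) ?_
  rw [orthonormal_iff_ite]
  intro i j
  simp only [lp.inner_single_left]
  by_cases h : i = j
  · subst h; simp
  · have : (i : ℕ) ≠ j := fun h' => h (Fin.ext h')
    simp [h, this, lp.single_apply]

theorem exists_great_circle_sphereFin {M : ℕ} (hM : 1 ≤ M) : ∃ (z : SphereFin M) (γ : ℝ → SphereFin M),
    Continuous γ ∧ ∀ θ, sphereInner z (γ θ) = Real.cos θ :=
  exists_great_circle (fun i : Fin 2 => EuclideanSpace.basisFun (Fin (M + 1)) ℝ (Fin.castLE (by omega) i))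
    ((EuclideanSpace.basisFun (Fin (M + 1)) ℝ).orthonormal.comp _ (Fin.castLE_injective (show 2 ≤ M + 1 by omega)))

end Path

/-! ### The two implications -/

theorem hasSum_inner_lp_two (x y : lp (fun _ : ℕ => ℝ) 2) :
    HasSum (fun n : ℕ => (x : ℕ → ℝ) n * (y : ℕ → ℝ) n) (inner ℝ x y) := by
  have h := lp.hasSum_inner (𝕜 := ℝ) x y
  simp only [RCLike.inner_apply, conj_trivial] at h
  simpa only [mul_comm] using h

/-- Multiplication by powers of the inner product preserves positivity. -/
theorem sum_mul_inner_pow_nonneg {ι : Type*} [Fintype ι] (x : ι → lp (fun _ : ℕ => ℝ) 2) (k : ℕ)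
    (c : ι → ℝ) : 0 ≤ ∑ i, ∑ j, c i * c j * inner ℝ (x i) (x j) ^ k := by
  induction k generalizing c with
  | zero =>
    have : ∑ i, ∑ j, c i * c j * inner ℝ (x i) (x j) ^ 0 = (∑ i, c i) * ∑ i, c i := by
      rw [Finset.sum_mul_sum]; simp only [pow_zero, mul_one]
    rw [this]
    exact mul_self_nonneg _
  | succ k ih =>
    -- One factor of the inner product is expanded over coordinates; each coordinate contributes a
    -- rank-one factor that is absorbed into the coefficients.
    have h : HasSum (fun n : ℕ => ∑ i, ∑ j, (c i * c j * inner ℝ (x i) (x j) ^ k) *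
        ((x i : ℕ → ℝ) n * (x j : ℕ → ℝ) n)) (∑ i, ∑ j, (c i * c j * inner ℝ (x i) (x j) ^ k) *
        inner ℝ (x i) (x j)) :=
      hasSum_sum fun i _ => hasSum_sum fun j _ => (hasSum_inner_lp_two (x i) (x j)).mul_left _
    have h2 : ∀ n, 0 ≤ ∑ i, ∑ j, (c i * c j * inner ℝ (x i) (x j) ^ k) *
        ((x i : ℕ → ℝ) n * (x j : ℕ → ℝ) n) := by
      intro n
      refine (ih (fun i => c i * (x i : ℕ → ℝ) n)).trans_eq ?_
      exact Finset.sum_congr rfl fun i _ => Finset.sum_congr rfl fun j _ => by ring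
    refine (h.nonneg h2).trans_eq ?_
    simp only [pow_succ, mul_assoc]

theorem positive_definite_of_hasSum {M : ℕ} (hM : 1 ≤ M) {F : ℝ → ℝ → ℝ} {c : ℕ → ℕ → ℝ}
    (hc : ∀ k l, 0 ≤ c k l)
    (h : ∀ t ∈ Set.Icc (-1 : ℝ) 1, ∀ s ∈ Set.Icc (-1 : ℝ) 1,
      HasSum (fun p : ℕ × ℕ => c p.1 p.2 * t ^ p.1 * (ultraspherical M p.2).eval s) (F t s)) :
    IsPositiveDefiniteKernel fun p q : SphereInf × SphereFin M =>
      F (inner ℝ (p.1 : lp (fun _ : ℕ => ℝ) 2) (q.1 : lp (fun _ : ℕ => ℝ) 2))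
        (sphereInner p.2 q.2) := by
  intro n x _ b
  have hT : ∀ i j, inner ℝ ((x i).1 : lp (fun _ : ℕ => ℝ) 2) ((x j).1 : lp (fun _ : ℕ => ℝ) 2)
      ∈ Set.Icc (-1 : ℝ) 1 := by
    intro i j
    have := abs_real_inner_le_norm ((x i).1 : lp (fun _ : ℕ => ℝ) 2) (x j).1
    rw [norm_eq_of_mem_sphere (x i).1, norm_eq_of_mem_sphere (x j).1, one_mul] at this
    exact abs_le.1 this
  have hs : HasSum (fun p : ℕ × ℕ => ∑ i, ∑ j, b i * b j * (c p.1 p.2 *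
      inner ℝ ((x i).1 : lp (fun _ : ℕ => ℝ) 2) ((x j).1 : lp (fun _ : ℕ => ℝ) 2) ^ p.1 *
      (ultraspherical M p.2).eval (sphereInner (x i).2 (x j).2)))
      (∑ i, ∑ j, b i * b j *
        F (inner ℝ ((x i).1 : lp (fun _ : ℕ => ℝ) 2) ((x j).1 : lp (fun _ : ℕ => ℝ) 2))
          (sphereInner (x i).2 (x j).2)) :=
    hasSum_sum fun i _ => hasSum_sum fun j _ =>
      (h _ (hT i j) _ (sphereInner_mem_Icc _ _)).mul_left _
  refine hs.nonneg fun p => ?_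
  refine sum_mul_ultraspherical_nonneg hM p.2 (fun i j => c p.1 p.2 *
      inner ℝ ((x i).1 : lp (fun _ : ℕ => ℝ) 2) ((x j).1 : lp (fun _ : ℕ => ℝ) 2) ^ p.1)
    (fun a => ?_) (fun i => (x i).2) b
  have e : ∑ i, ∑ j, a i * a j * (c p.1 p.2 *
      inner ℝ ((x i).1 : lp (fun _ : ℕ => ℝ) 2) ((x j).1 : lp (fun _ : ℕ => ℝ) 2) ^ p.1)
      = c p.1 p.2 * ∑ i, ∑ j, a i * a j *
      inner ℝ ((x i).1 : lp (fun _ : ℕ => ℝ) 2) ((x j).1 : lp (fun _ : ℕ => ℝ) 2) ^ p.1 := by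
    simp only [Finset.mul_sum]
    exact Finset.sum_congr rfl fun i _ => Finset.sum_congr rfl fun j _ => by ring
  rw [e]
  exact mul_nonneg (hc _ _) (sum_mul_inner_pow_nonneg (fun i => ((x i).1 : lp (fun _ : ℕ => ℝ) 2)) _ a)

-- Schoenberg's theorem is applied to each ultraspherical coefficient separately; the remaining work
-- is summability over all degrees and the identification of the resulting series with `F`.
open MeasureTheory in
theorem exists_hasSum_of_positive_definite {M : ℕ} (hM : 1 ≤ M) {F : ℝ → ℝ → ℝ}
    (hF : Continuous (Function.uncurry F))
    (hpd : IsPositiveDefiniteKernel fun p q : SphereInf × SphereFin M =>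
      F (inner ℝ (p.1 : lp (fun _ : ℕ => ℝ) 2) (q.1 : lp (fun _ : ℕ => ℝ) 2))
        (sphereInner p.2 q.2)) :
    ∃ c : ℕ → ℕ → ℝ, (∀ k l, 0 ≤ c k l) ∧ Summable (fun p : ℕ × ℕ => c p.1 p.2) ∧
      ∀ t ∈ Set.Icc (-1 : ℝ) 1, ∀ s ∈ Set.Icc (-1 : ℝ) 1,
        HasSum (fun p : ℕ × ℕ => c p.1 p.2 * t ^ p.1 * (ultraspherical M p.2).eval s) (F t s) := by
  have hFt : ∀ t, Continuous (F t) := fun t => hF.comp (f := fun s : ℝ => (t, s)) (by fun_prop)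
  have hsurj : ∀ s ∈ Set.Icc (-1 : ℝ) 1, ∃ z w : SphereFin M, sphereInner z w = s := by
    intro s hs
    obtain ⟨z, γ, -, hγ⟩ := exists_great_circle_sphereFin hM
    exact ⟨z, γ (Real.arccos s), by rw [hγ, Real.cos_arccos hs.1 hs.2]⟩
  have hR : ∀ l, ∀ s ∈ Set.Icc (-1 : ℝ) 1, |(ultraspherical M l).eval s| ≤ 1 := by
    intro l s hs
    obtain ⟨z, w, rfl⟩ := hsurj s hs
    exact abs_ultraspherical_le_one hM l z w
  choose a ha _ hat using fun l => schoenberg_sphereInf (continuous_zonalCoeff (M := M) hF l)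
    (zonalCoeff_positive_definite hM hF hpd l)
  have ha1 : ∀ l, HasSum (a l) (zonalCoeff M (F 1) l) := by
    intro l
    simpa using hat l 1 (by norm_num)
  have hpos := ultrasphericalNormSq_pos hM
  -- Take the same point `x` on the Hilbert sphere twice, which forces `t = 1`, with coefficients
  -- `1` and `-1`.
  have hB : ∀ s ∈ Set.Icc (-1 : ℝ) 1, F 1 s ≤ F 1 1 := by
    intro s hs
    obtain ⟨z, w, rfl⟩ := hsurj s hs
    obtain ⟨x, -⟩ := exists_great_circle_sphereInf
    have h := hpd.sum_nonneg ![(x, z), (x, w)] ![1, -1]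
    simp [Fin.sum_univ_two, sphereInner_self, sphereInner_comm w z] at h
    linarith
  obtain ⟨c, hcdef⟩ : ∃ c : ℕ → ℕ → ℝ, ∀ k l, c k l = a l k / ultrasphericalNormSq M l :=
    ⟨fun k l => a l k / ultrasphericalNormSq M l, fun _ _ => rfl⟩
  have hc : ∀ k l, 0 ≤ c k l := fun k l => by
    rw [hcdef]
    exact div_nonneg (ha l k) (hpos l).le
  have hcl : ∀ l, HasSum (fun k => c k l) (zonalCoeff M (F 1) l / ultrasphericalNormSq M l) := by
    intro l
    simp only [hcdef]
    exact (ha1 l).div_const _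
  -- Summing over `k` first, for fixed `l`, collapses to the normalized coefficient of `F 1`, and
  -- these have bounded partial sums.
  have hcs : Summable fun p : ℕ × ℕ => c p.1 p.2 := by
    have h1 : Summable fun p : ℕ × ℕ => c p.2 p.1 := by
      rw [summable_prod_of_nonneg fun p => hc _ _]
      refine ⟨fun l => (hcl l).summable, ?_⟩
      simp only [(hcl _).tsum_eq]
      have h3 : ∀ l, 0 ≤ zonalCoeff M (F 1) l := fun l => (ha1 l).nonneg (ha l)
      exact summable_of_sum_le (fun l => div_nonneg (h3 l) (hpos l).le)
        (sum_zonalCoeff_le hM (hFt 1).continuousOn hB h3)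
    exact h1.prod_symm
  refine ⟨c, hc, hcs, fun t ht => ?_⟩
  have hbound : ∀ p : ℕ × ℕ, ∀ s ∈ Set.Icc (-1 : ℝ) 1,
      ‖c p.1 p.2 * t ^ p.1 * (ultraspherical M p.2).eval s‖ ≤ c p.1 p.2 := by
    intro p s hs
    rw [norm_mul, norm_mul, norm_pow, Real.norm_of_nonneg (hc _ _), Real.norm_eq_abs,
      Real.norm_eq_abs]
    refine (mul_le_of_le_one_right (by have := hc p.1 p.2; positivity) (hR _ s hs)).trans ?_
    exact mul_le_of_le_one_right (hc _ _) (pow_le_one₀ (abs_nonneg t) (abs_le.2 ht))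
  set Φ : ℝ → ℝ := fun s => ∑' p : ℕ × ℕ, c p.1 p.2 * t ^ p.1 * (ultraspherical M p.2).eval s with hΦ
  have hΦc : ContinuousOn Φ (Set.Icc (-1) 1) :=
    continuousOn_tsum (fun p => by fun_prop) hcs hbound
  -- Termwise integration is legitimate since the terms are dominated by `c`; orthogonality then
  -- keeps only `l = m`, which is Schoenberg's series for the `m`-th coefficient.
  have hcoef : ∀ m, zonalCoeff M Φ m = zonalCoeff M (F t) m := by
    intro m
    have hcont : ∀ p : ℕ × ℕ, Continuous fun x : SphereFin M × SphereFin M =>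
        c p.1 p.2 * t ^ p.1 * (ultraspherical M p.2).eval (sphereInner x.1 x.2) *
          (ultraspherical M m).eval (sphereInner x.1 x.2) := fun p => by fun_prop
    have hI := hasSum_integral_of_summable_integral_norm (μ := spherePairs M)
      (F := fun (p : ℕ × ℕ) (x : SphereFin M × SphereFin M) =>
        c p.1 p.2 * t ^ p.1 * (ultraspherical M p.2).eval (sphereInner x.1 x.2) *
          (ultraspherical M m).eval (sphereInner x.1 x.2))
      (fun p => integrable_sphereProb_prod (hcont p))
      (Summable.of_nonneg_of_le (fun p => integral_nonneg fun x => norm_nonneg _) (fun p => by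
        calc _ ≤ ∫ _x, c p.1 p.2 ∂spherePairs M := by
              refine integral_mono (integrable_sphereProb_prod (hcont p).norm)
                (integrable_const _) fun x => ?_
              simp only [norm_mul _ (eval _ (ultraspherical M m))]
              refine (mul_le_of_le_one_right (norm_nonneg _) (hR _ _ (sphereInner_mem_Icc _ _))).trans
                (hbound p _ (sphereInner_mem_Icc _ _))
          _ = c p.1 p.2 := by simp) hcs)
    have hval : ∀ p : ℕ × ℕ, ∫ x, c p.1 p.2 * t ^ p.1 *
        (ultraspherical M p.2).eval (sphereInner x.1 x.2) *
          (ultraspherical M m).eval (sphereInner x.1 x.2) ∂spherePairs M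
        = c p.1 p.2 * t ^ p.1 * if p.2 = m then ultrasphericalNormSq M m else 0 := by
      intro p
      rw [← zonalCoeff_ultraspherical hM, zonalCoeff, ← integral_const_mul]
      simp only [mul_assoc]
    simp only [hval, tsum_mul_right] at hI
    change HasSum _ (zonalCoeff M Φ m) at hI
    have hinj : Function.Injective fun k : ℕ => (k, m) := fun k k' h => (Prod.mk.inj h).1
    rw [← hinj.hasSum_iff] at hI
    · have h2 := hat m t ht
      have h3 : ((fun p : ℕ × ℕ => c p.1 p.2 * t ^ p.1 *
          if p.2 = m then ultrasphericalNormSq M m else 0) ∘ fun k : ℕ => (k, m))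
          = fun k => a m k * t ^ k := by
        funext k
        have := (hpos m).ne'
        simp only [Function.comp_apply, if_true, hcdef]
        field_simp
      rw [h3] at hI
      exact hI.unique h2
    · intro p hp
      have : p.2 ≠ m := fun h => hp ⟨p.1, by rw [← h]⟩
      rw [if_neg this, mul_zero]
  intro s hs
  have hsum := (Summable.of_norm_bounded hcs fun p => hbound p s hs).hasSum
  have heq : Φ s = F t s := by
    obtain ⟨z, w, rfl⟩ := hsurj s hs
    have hΦ' := continuous_comp_sphereInner (M := M) hΦc
    have hF' := continuous_comp_sphereInner (M := M) (hFt t).continuousOn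
    refine sub_eq_zero.1 (eq_zero_of_zonalCoeff_eq_zero hM (φ := fun s => Φ s - F t s)
      (hΦc.sub (hFt t).continuousOn) (fun l => ?_) z w)
    have h1 : Continuous fun x : SphereFin M × SphereFin M =>
        Φ (sphereInner x.1 x.2) * (ultraspherical M l).eval (sphereInner x.1 x.2) :=
      hΦ'.mul (by fun_prop)
    have h2 : Continuous fun x : SphereFin M × SphereFin M =>
        F t (sphereInner x.1 x.2) * (ultraspherical M l).eval (sphereInner x.1 x.2) :=
      hF'.mul (by fun_prop)
    unfold zonalCoeff at hcoef ⊢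
    simp only [sub_mul]
    rw [integral_sub (integrable_sphereProb_prod h1) (integrable_sphereProb_prod h2), hcoef,
      sub_self]
  rw [← heq]
  exact hsum

/-- No continuity of `f` is given, and it is arbitrary off the square. Moving along great circles by
`Real.arccos`, which is continuous on all of `ℝ`, reads off from `K` a globally continuous
substitute. -/
theorem exists_continuous_isotropicPart {M : ℕ} (hM : 1 ≤ M)
    {K : SphereInf × SphereFin M → SphereInf × SphereFin M → ℝ}
    (hKcont : Continuous (Function.uncurry K)) {f : ℝ → ℝ → ℝ} (hf : IsIsotropicPart K f) :
    ∃ F : ℝ → ℝ → ℝ, Continuous (Function.uncurry F) ∧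
      ∀ t ∈ Set.Icc (-1 : ℝ) 1, ∀ s ∈ Set.Icc (-1 : ℝ) 1, F t s = f t s := by
  obtain ⟨x, γ, hγ, hxγ⟩ := exists_great_circle_sphereInf
  obtain ⟨z, δ, hδ, hzδ⟩ := exists_great_circle_sphereFin hM
  refine ⟨fun t s => K (x, z) (γ (Real.arccos t), δ (Real.arccos s)), ?_, fun t ht s hs => ?_⟩
  · have h1 : Continuous fun p : ℝ × ℝ =>
        ((x, z), (γ (Real.arccos p.1), δ (Real.arccos p.2))) :=
      continuous_const.prodMk
        ((hγ.comp (Real.continuous_arccos.comp continuous_fst)).prodMk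
          (hδ.comp (Real.continuous_arccos.comp continuous_snd)))
    exact hKcont.comp h1
  · have h := hf x (γ (Real.arccos t)) z (δ (Real.arccos s))
    rw [hxγ, Real.cos_arccos ht.1 ht.2] at h
    have h2 := hzδ (Real.arccos s)
    rw [sphereInner, Real.cos_arccos hs.1 hs.2] at h2
    rw [h2] at h
    exact h

end

theorem mainTheorem2 (M : ℕ) (hM : 1 ≤ M)
    (K : SphereInf × SphereFin M → SphereInf × SphereFin M → ℝ)
    (hKcont : Continuous (Function.uncurry K))
    (f : ℝ → ℝ → ℝ) (hf : IsIsotropicPart K f) :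
    IsPositiveDefiniteKernel K ↔
      ∃ c : ℕ → ℕ → ℝ, (∀ k l, 0 ≤ c k l) ∧
        Summable (fun p : ℕ × ℕ => c p.1 p.2) ∧
        ∀ t ∈ Set.Icc (-1 : ℝ) 1, ∀ s ∈ Set.Icc (-1 : ℝ) 1,
          HasSum (fun p : ℕ × ℕ => c p.1 p.2 * t ^ p.1 * normalizedGegenbauer M p.2 s)
            (f t s) := by
  simp only [normalizedGegenbauer_eq hM]
  obtain ⟨F, hF, hFf⟩ := exists_continuous_isotropicPart hM hKcont hf
  have hK : K = fun p q : SphereInf × SphereFin M =>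
      F (inner ℝ (p.1 : lp (fun _ : ℕ => ℝ) 2) (q.1 : lp (fun _ : ℕ => ℝ) 2))
        (sphereInner p.2 q.2) := by
    funext p q
    have := abs_real_inner_le_norm (p.1 : lp (fun _ : ℕ => ℝ) 2) q.1
    rw [norm_eq_of_mem_sphere p.1, norm_eq_of_mem_sphere q.1, one_mul] at this
    rw [hFf _ (abs_le.1 this) _ (sphereInner_mem_Icc _ _)]
    exact hf p.1 q.1 p.2 q.2
  constructor
  · intro h
    rw [hK] at h
    obtain ⟨c, hc, hcs, hsum⟩ := exists_hasSum_of_positive_definite hM hF h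
    refine ⟨c, hc, hcs, fun t ht s hs => ?_⟩
    rw [← hFf t ht s hs]
    exact hsum t ht s hs
  · rintro ⟨c, hc, -, hsum⟩
    rw [hK]
    refine positive_definite_of_hasSum hM hc fun t ht s hs => ?_
    rw [hFf t ht s hs]
    exact hsum t ht s hs
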